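/- Let $s\in(0,1)$, let $N\ge 1$ be an integer with $N>2s$, let $m>0$, and put $2^*_s:=\frac{2N}{N-2s}$. Let $g\colon\mathbb R\to\mathbb R$ satisfy (g0) $g$ is continuous and $g(0)=0$; (g1) $\limsup_{t\to0}\frac{g(t)}{t}\le 0$; (g2) $\limsup_{|t|\to+\infty}\frac{|g(t)|}{|t|^{2^*_s-1}}<\infty$, and let $G(t):=\int_0^t g(\tau)\,d\tau$. Let $H^s(\mathbb R^N)$ be the fractional Sobolev space of real-valued functions $u\in L^2(\mathbb R^N)$ with $|\xi|^s\mathcal F(u)\in L^2(\mathbb R^N)$. For $\mu\in\mathbb R$ and $u\in H^s(\mathbb R^N)$ define, with values in $\mathbb R\cup\{+\infty\}$, $$K(u):=\frac12\int_{\mathbb R^N}|(-\Delta)^{s/2}u|^2\,dx-\int_{\mathbb R^N}G(u)\,dx,$$ $$I^m(\mu,u):=\frac12\int_{\mathbb R^N}|(-\Delta)^{s/2}u|^2\,dx+\frac\mu2\Big(\int_{\mathbb R^N}u^2\,dx-m\Big)-\int_{\mathbb R^N}G(u)\,dx,$$ $$P(\mu,u):=\int_{\mathbb R^N}|(-\Delta)^{s/2}u|^2\,dx+2^*_s\int_{\mathbb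 R^N}\Big(\frac\mu2u^2-G(u)\Big)\,dx,$$ and let $$\mathcal S_m:=\Big\{u\in H^s(\mathbb R^N):\int_{\mathbb R^N}u^2\,dx=m\Big\},\qquad \mathcal P:=\{(\mu,u)\in\mathbb R\times H^s(\mathbb R^N):u\ne0,\ P(\mu,u)=0\}.$$ Then for every $\mu\in\mathbb R$ and every $u\in H^s(\mathbb R^N)$ the following are equivalent: (a) $u$ is an $L^2$-minimum with Lagrange multiplier $\mu$, that is, $u\in\mathcal S_m$, $K(u)=\min_{\mathcal S_m}K$, and $u$ is a weak solution of $(-\Delta)^su+\mu u=g(u)$ in $\mathbb R^N$, meaning $$\int_{\mathbb R^N}(-\Delta)^{s/2}u\,(-\Delta)^{s/2}\varphi\,dx+\mu\int_{\mathbb R^N}u\varphi\,dx=\int_{\mathbb R^N}g(u)\varphi\,dx\qquad\text{for all }\varphi\in H^s(\mathbb R^N)\cap L^1(\mathbb R^N);$$ (b) $(\mu,u)$ is a Pohožaev minimum over $\mathcal P$, that is, $(\mu,u)\in\mathcal P$ and $I^m(\mu,u)=\min_{\mathcal P}I^m$. -/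

import Mathlib

open MeasureTheory Filter Topology
open scoped FourierTransform ENNReal

noncomputable section

namespace FracNLS

/-- The Euclidean space `ℝ^N`. -/
abbrev RN (N : ℕ) : Type := EuclideanSpace ℝ (Fin N)

/-- The Fourier transform (Plancherel extension) of a real-valued `u ∈ L²(ℝ^N)`. -/
def fourierL2 {N : ℕ} (u : Lp ℝ 2 (volume : Measure (RN N))) :
    Lp ℂ 2 (volume : Measure (RN N)) :=
  𝓕 (Complex.ofRealCLM.compLp u)

/-- The function `|2πξ|^s 𝓕u(ξ)`. Mathlib's Fourier transform is normalised as
`𝓕u(ξ) = ∫ exp(-2πi x·ξ) u(x) dx`, for which the symbol of `-Δ` is `|2πξ|²`. -/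
def symbolMul {N : ℕ} (s : ℝ) (u : Lp ℝ 2 (volume : Measure (RN N))) : RN N → ℂ :=
  fun ξ => (((2 * Real.pi * ‖ξ‖) ^ s : ℝ) : ℂ) * fourierL2 u ξ

theorem fourierL2_zero {N : ℕ} : fourierL2 (0 : Lp ℝ 2 (volume : Measure (RN N))) = 0 := by
  have h : Complex.ofRealCLM.compLp (0 : Lp ℝ 2 (volume : Measure (RN N))) = 0 :=
    map_zero (Complex.ofRealCLM.compLpL 2 (volume : Measure (RN N)))
  have h' : (𝓕 (0 : Lp ℂ 2 (volume : Measure (RN N)))) = 0 :=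
    map_zero (Lp.fourierTransformₗᵢ (RN N) ℂ)
  rw [fourierL2, h, h']

theorem fourierL2_add {N : ℕ} (u v : Lp ℝ 2 (volume : Measure (RN N))) :
    fourierL2 (u + v) = fourierL2 u + fourierL2 v := by
  have h : Complex.ofRealCLM.compLp (u + v)
      = Complex.ofRealCLM.compLp u + Complex.ofRealCLM.compLp v :=
    map_add (Complex.ofRealCLM.compLpL 2 (volume : Measure (RN N))) u v
  rw [fourierL2, h]
  exact map_add (Lp.fourierTransformₗᵢ (RN N) ℂ) _ _

theorem fourierL2_smul {N : ℕ} (c : ℝ) (u : Lp ℝ 2 (volume : Measure (RN N))) :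
    fourierL2 (c • u) = (c : ℂ) • fourierL2 u := by
  have h : Complex.ofRealCLM.compLp (c • u) = (c : ℂ) • Complex.ofRealCLM.compLp u := by
    have h1 : Complex.ofRealCLM.compLp (c • u) = c • Complex.ofRealCLM.compLp u :=
      map_smul (Complex.ofRealCLM.compLpL 2 (volume : Measure (RN N))) c u
    rw [h1]
    ext1
    filter_upwards [Lp.coeFn_smul c (Complex.ofRealCLM.compLp u),
      Lp.coeFn_smul (c : ℂ) (Complex.ofRealCLM.compLp u)] with x h2 h3
    rw [h2, h3]
    simp
  rw [fourierL2, h]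
  exact map_smul (Lp.fourierTransformₗᵢ (RN N) ℂ) _ _

/-- The fractional Sobolev space `H^s(ℝ^N)` of real-valued functions: all `u ∈ L²(ℝ^N)` such that
`|ξ|^s 𝓕u ∈ L²(ℝ^N)`. Its elements are classes of functions modulo a.e. equality. -/
def Hs (N : ℕ) (s : ℝ) : Submodule ℝ (Lp ℝ 2 (volume : Measure (RN N))) where
  carrier := {u | MemLp (symbolMul s u) 2 volume}
  zero_mem' := by
    refine (MemLp.zero (p := 2) (μ := (volume : Measure (RN N))) (ε := ℂ)).ae_eq ?_
    filter_upwards [Lp.coeFn_zero ℂ 2 (volume : Measure (RN N))] with ξ h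
    simp only [symbolMul, fourierL2_zero, h, Pi.zero_apply, mul_zero]
  add_mem' := by
    intro u v hu hv
    refine (MemLp.add hu hv).ae_eq ?_
    filter_upwards [Lp.coeFn_add (fourierL2 u) (fourierL2 v)] with ξ h
    rw [Pi.add_apply] at h
    simp only [symbolMul, Pi.add_apply, fourierL2_add, h, mul_add]
  smul_mem' := by
    intro c u hu
    refine (MemLp.const_smul hu (c : ℂ)).ae_eq ?_
    filter_upwards [Lp.coeFn_smul (c : ℂ) (fourierL2 u)] with ξ h
    rw [Pi.smul_apply, smul_eq_mul] at h
    simp only [symbolMul, Pi.smul_apply, smul_eq_mul, fourierL2_smul, h, mul_left_comm]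

/-- `(-Δ)^{s/2} u = 𝓕⁻¹(|2πξ|^s 𝓕u) ∈ L²(ℝ^N)` for `u ∈ H^s(ℝ^N)`. As `u` is real-valued and the
symbol is even, this function is real-valued, but it is recorded as an element of the complex
`L²` space. -/
def halfLap {N : ℕ} {s : ℝ} (u : Hs N s) : Lp ℂ 2 (volume : Measure (RN N)) :=
  𝓕⁻ (MemLp.toLp (symbolMul s (u : Lp ℝ 2 (volume : Measure (RN N)))) u.2)

/-- `∫ |(-Δ)^{s/2} u|² dx`. -/
def kinetic {N : ℕ} {s : ℝ} (u : Hs N s) : ℝ :=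
  ∫ x, ‖halfLap u x‖ ^ 2

/-- `∫ (-Δ)^{s/2} u (-Δ)^{s/2} φ dx`. Both functions take real values, and for such values
the real inner product of `ℂ` is the ordinary product. -/
def kineticForm {N : ℕ} {s : ℝ} (u φ : Hs N s) : ℝ :=
  ∫ x, inner ℝ (halfLap u x) (halfLap φ x)

/-- The mass `∫ u² dx`. -/
def mass {N : ℕ} {s : ℝ} (u : Hs N s) : ℝ :=
  ∫ x, ((u : Lp ℝ 2 (volume : Measure (RN N))) x) ^ 2

/-- The critical Sobolev exponent `2^*_s = 2N / (N - 2s)`. -/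
def critExp (N : ℕ) (s : ℝ) : ℝ := 2 * N / (N - 2 * s)

/-- The primitive `G(t) = ∫_0^t g(τ) dτ`. -/
def primitive (g : ℝ → ℝ) (t : ℝ) : ℝ := ∫ τ in (0 : ℝ)..t, g τ

/-- (g0): `g` is continuous and `g 0 = 0`. -/
def CondG0 (g : ℝ → ℝ) : Prop := Continuous g ∧ g 0 = 0

/-- (g1): `limsup_{t → 0} g(t)/t ≤ 0`, the upper limit being taken in `[-∞, +∞]`. -/
def CondG1 (g : ℝ → ℝ) : Prop :=
  limsup (fun t : ℝ => ((g t / t : ℝ) : EReal)) (𝓝[≠] 0) ≤ 0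

/-- (g2): `limsup_{|t| → +∞} |g(t)| / |t|^{2^*_s - 1} < ∞`, the upper limit being taken in
`[-∞, +∞]`. -/
def CondG2 (N : ℕ) (s : ℝ) (g : ℝ → ℝ) : Prop :=
  limsup (fun t : ℝ => ((|g t| / |t| ^ (critExp N s - 1) : ℝ) : EReal))
    (comap (fun t : ℝ => |t|) atTop) < ⊤

/-- The integral `∫ f = ∫ f⁺ - ∫ f⁻` with values in `[-∞, +∞]`, meaningful as soon as at least one
of the two terms is finite. -/
def extIntegral {N : ℕ} (f : RN N → ℝ) : EReal :=
  ((∫⁻ x, ENNReal.ofReal (f x) : ℝ≥0∞) : EReal) - ((∫⁻ x, ENNReal.ofReal (-f x) : ℝ≥0∞) : EReal)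

/-- `∫ G(u) dx`. Under (g0)-(g2) the positive part of `G(u)` is integrable for every
`u ∈ H^s(ℝ^N)`, so that the value lies in `[-∞, +∞)`. -/
def potential {N : ℕ} {s : ℝ} (g : ℝ → ℝ) (u : Hs N s) : EReal :=
  extIntegral fun x => primitive g ((u : Lp ℝ 2 (volume : Measure (RN N))) x)

/-- The energy `K(u) = 1/2 ∫ |(-Δ)^{s/2} u|² - ∫ G(u)`, with values in `ℝ ∪ {+∞}`
under (g0)-(g2). -/
def energy {N : ℕ} {s : ℝ} (g : ℝ → ℝ) (u : Hs N s) : EReal :=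
  ((kinetic u / 2 : ℝ) : EReal) - potential g u

/-- The Lagrangian
`I^m(μ,u) = 1/2 ∫ |(-Δ)^{s/2} u|² + μ/2 (∫ u² - m) - ∫ G(u)`. -/
def lagrangian {N : ℕ} {s : ℝ} (g : ℝ → ℝ) (m : ℝ) (p : ℝ × Hs N s) : EReal :=
  ((kinetic p.2 / 2 + p.1 / 2 * (mass p.2 - m) : ℝ) : EReal) - potential g p.2

/-- The Pohozaev functional
`P(μ,u) = ∫ |(-Δ)^{s/2} u|² + 2^*_s ∫ (μ/2 u² - G(u))`. -/
def pohozaev {N : ℕ} {s : ℝ} (g : ℝ → ℝ) (p : ℝ × Hs N s) : EReal :=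
  ((kinetic p.2 : ℝ) : EReal) +
    ((critExp N s : ℝ) : EReal) * (((p.1 / 2 * mass p.2 : ℝ) : EReal) - potential g p.2)

/-- The `L²`-sphere `S_m = {u ∈ H^s(ℝ^N) | ∫ u² = m}`. -/
def sphere (N : ℕ) (s m : ℝ) : Set (Hs N s) := {u | mass u = m}

/-- The Pohozaev set `{(μ,u) ∈ ℝ × H^s(ℝ^N) | u ≠ 0, P(μ,u) = 0}`. -/
def pohozaevSet (N : ℕ) (s : ℝ) (g : ℝ → ℝ) : Set (ℝ × Hs N s) :=
  {p | p.2 ≠ 0 ∧ pohozaev g p = 0}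

/-- `u` is a weak solution of `(-Δ)^s u + μ u = g(u)` in `ℝ^N`: the equation holds against every
test function `φ ∈ H^s(ℝ^N) ∩ L¹(ℝ^N)`. Under (g0)-(g2) all the integrands are integrable. -/
def IsWeakSolution {N : ℕ} {s : ℝ} (g : ℝ → ℝ) (μ : ℝ) (u : Hs N s) : Prop :=
  ∀ φ : Hs N s, Integrable (φ : Lp ℝ 2 (volume : Measure (RN N))) volume →
    kineticForm u φ
      + μ * ∫ x, (u : Lp ℝ 2 (volume : Measure (RN N))) x
          * (φ : Lp ℝ 2 (volume : Measure (RN N))) x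
      = ∫ x, g ((u : Lp ℝ 2 (volume : Measure (RN N))) x)
          * (φ : Lp ℝ 2 (volume : Measure (RN N))) x

/-- `u` is an `L²`-minimum with Lagrange multiplier `μ`: it lies on the sphere `S_m`, minimises
the energy there, and solves `(-Δ)^s u + μ u = g(u)`. -/
def IsL2Minimum {N : ℕ} {s : ℝ} (g : ℝ → ℝ) (m μ : ℝ) (u : Hs N s) : Prop :=
  u ∈ sphere N s m ∧ IsMinOn (energy g) (sphere N s m) u ∧ IsWeakSolution g μ u

/-- `(μ,u)` is a Pohozaev minimum: it lies in the Pohozaev set and minimises `I^m` there. -/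
def IsPohozaevMinimum {N : ℕ} {s : ℝ} (g : ℝ → ℝ) (m μ : ℝ) (u : Hs N s) : Prop :=
  (μ, u) ∈ pohozaevSet N s g ∧ IsMinOn (lagrangian g m) (pohozaevSet N s g) (μ, u)

end FracNLS

end

open MeasureTheory Filter Topology
open scoped FourierTransform ENNReal

noncomputable section

namespace FracNLS

/-! Write T, M, V for the kinetic term, the mass and ∫ G(u), and p for the critical exponent. For u
≠ 0 with G(u) integrable, P(μ,u) is affine in μ with positive slope, so the Pohozaev set is a graph:
μ = (2/M)(V - T/p). If G(u) is not integrable, then P = +∞. On the graph I^m becomes a functional of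
u alone, J(u) = (s/N) T - (m/M)(V - T/p) (`reducedLagrangian`), and J = K on the sphere because 1/2
= s/N + 1/p.

Dilate v to mass m, with x = m/M and a = (N-2s)/N. This turns T into x^a T and V into xV, while J(v)
= (T/2)(1 - a + ax) - xV. Bernoulli's inequality x^a ≤ 1 - a + ax, strict for x ≠ 1, shows that the
dilated function w has K(w) ≤ J(v), strictly when M ≠ m (`exists_mass_eq_le_reducedLagrangian`).
Hence minimising J over all admissible u and minimising K over the sphere are the same problem.

It remains to identify the multiplier. Differentiating J at a minimiser of mass m along integrable
directions gives the equation with exactly the Pohozaev multiplier (`isWeakSolution_of_forall_le`).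
A nonzero u cannot solve the equation with two multipliers (`IsWeakSolution.multiplier_unique`), so
the μ in (a) is that one. No regularity theory or Pohozaev identity for general solutions is needed.

The analytic input is the critical Sobolev embedding, which makes the positive part of G(u)
integrable. -/

/-! ### Fourier inversion and the critical Sobolev embedding. -/

/-- On `L¹ ∩ L²` the inverse Fourier transform of `L²` is given by the integral formula. -/
theorem fourierInv_Lp_ae_eq {N : ℕ} (f : Lp ℂ 2 (volume : Measure (RN N))) (hf : Integrable f) :
    (𝓕⁻ f : Lp ℂ 2 (volume : Measure (RN N))) =ᵐ[volume] 𝓕⁻ (f : RN N → ℂ) := by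
  have hb := Real.Lp.fourierTransformInv_toLp (memLp_one_iff_integrable.2 hf)
  have hcont : Continuous (𝓕⁻ (f : RN N → ℂ)) := by
    rw [← hb]; exact BoundedContinuousFunction.continuous _
  -- Both sides are compared as distributions. The `L²` transform is dual to the Schwartz one, and
  -- the integral formula satisfies the same duality by Fubini.
  refine ae_eq_of_integral_contDiff_smul_eq
    ((Lp.memLp (𝓕⁻ f : Lp ℂ 2 (volume : Measure (RN N)))).locallyIntegrable (by norm_num))
    hcont.locallyIntegrable ?_
  intro g g_smooth g_cpt
  have hg₁ : HasCompactSupport (Complex.ofRealCLM ∘ g) := g_cpt.comp_left rfl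
  have hg₂ : ContDiff ℝ (⊤ : ℕ∞) (Complex.ofRealCLM ∘ g) := by fun_prop
  set G := hg₁.toSchwartzMap hg₂ with hG
  have h1 : (𝓕⁻ (f : TemperedDistribution (RN N) ℂ)) G
      = ((𝓕⁻ f : Lp ℂ 2 (volume : Measure (RN N))) : TemperedDistribution (RN N) ℂ) G := by
    rw [Lp.fourierInv_toTemperedDistribution_eq]
  rw [TemperedDistribution.fourierInv_apply, Lp.toTemperedDistribution_apply,
    Lp.toTemperedDistribution_apply] at h1
  have h2 : ∫ x, (𝓕⁻ G) x • f x = ∫ x, G x • 𝓕⁻ (f : RN N → ℂ) x := by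
    have := VectorFourier.integral_fourierIntegral_smul_eq_flip (μ := (volume : Measure (RN N)))
      (ν := (volume : Measure (RN N))) (L := -innerₗ (RN N)) Real.continuous_fourierChar
      (continuous_inner (𝕜 := ℝ) (E := RN N)).neg (f := G) (g := f)
      G.integrable hf
    rw [SchwartzMap.fourierInv_coe]
    convert! this using 4
    simp [Real.fourierInv_eq, VectorFourier.fourierIntegral, real_inner_comm]
  rw [h2] at h1
  simpa [hG] using h1.symm

theorem norm_fourierInv_Lp_le {N : ℕ} (f : Lp ℂ 2 (volume : Measure (RN N))) (hf : Integrable f) :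
    ∀ᵐ x, ‖(𝓕⁻ f : Lp ℂ 2 (volume : Measure (RN N))) x‖ ≤ ∫ ξ, ‖f ξ‖ := by
  filter_upwards [fourierInv_Lp_ae_eq f hf] with x hx
  rw [hx, Real.fourierInv_eq]
  refine (norm_integral_le_integral_norm _).trans (le_of_eq ?_)
  simp [Circle.norm_smul]

theorem ae_ne_zero {N : ℕ} (hN : 0 < N) : ∀ᵐ ξ : RN N, ξ ≠ 0 := by
  have : Nonempty (Fin N) := ⟨⟨0, hN⟩⟩
  have : Nontrivial (RN N) := inferInstance
  have : (volume : Measure (RN N)) {0} = 0 := measure_singleton 0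
  exact measure_eq_zero_iff_ae_notMem.1 this

theorem integrableOn_ball_norm_rpow {N : ℕ} {s : ℝ} (hN0 : 0 < N) (hN : 2 * s < N) (A : ℝ) :
    IntegrableOn (fun ξ : RN N => (2 * Real.pi * ‖ξ‖) ^ (-(2 * s))) (Metric.ball 0 A) := by
  refine integrableOn_ball_of_norm_le_rpow (C := (2 * Real.pi) ^ (-(2 * s))) (α := 2 * s)
    (by rw [finrank_euclideanSpace_fin]; exact hN0)
    (by rw [finrank_euclideanSpace_fin]; exact hN) ?_ ?_
  · refine Eventually.of_forall fun ξ => ?_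
    rw [Real.norm_of_nonneg (by positivity), Real.mul_rpow (by positivity) (by positivity)]
  · exact Measurable.aestronglyMeasurable (by fun_prop)

theorem setIntegral_ball_norm_rpow {N : ℕ} {s : ℝ} {A : ℝ} (hA : 0 < A) :
    ∫ ξ : RN N in Metric.ball 0 A, (2 * Real.pi * ‖ξ‖) ^ (-(2 * s))
      = A ^ ((N : ℝ) - 2 * s) *
        ∫ ξ : RN N in Metric.ball 0 1, (2 * Real.pi * ‖ξ‖) ^ (-(2 * s)) := by
  have h := Measure.setIntegral_comp_smul_of_pos (volume : Measure (RN N))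
    (fun ξ : RN N => (2 * Real.pi * ‖ξ‖) ^ (-(2 * s))) (Metric.ball 0 1) hA
  rw [smul_unitBall_of_pos hA] at h
  have h2 : ∀ ξ : RN N, (2 * Real.pi * ‖A • ξ‖) ^ (-(2 * s))
      = A ^ (-(2 * s)) * (2 * Real.pi * ‖ξ‖) ^ (-(2 * s)) := by
    intro ξ
    rw [norm_smul, Real.norm_of_nonneg hA.le, ← Real.mul_rpow (by positivity) (by positivity)]
    ring_nf
  simp only [h2, integral_const_mul, smul_eq_mul] at h
  have h3 : A ^ ((N : ℝ) - 2 * s) = A ^ N * A ^ (-(2 * s)) := by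
    rw [sub_eq_add_neg, Real.rpow_add hA, Real.rpow_natCast]
  have h4 : A ^ N ≠ 0 := by positivity
  rw [h3, mul_assoc, h]
  simp only [finrank_euclideanSpace, Fintype.card_fin]
  field_simp

/-- The `L¹` norm of the low frequencies of `F` is controlled by `∫ |2πξ|^{2s} |F|²`. -/
theorem exists_setIntegral_ball_le {N : ℕ} {s : ℝ} (hN0 : 0 < N) (hN : 2 * s < N)
    (F : Lp ℂ 2 (volume : Measure (RN N)))
    (hF : MemLp (fun ξ => (((2 * Real.pi * ‖ξ‖) ^ s : ℝ) : ℂ) * F ξ) 2 volume) :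
    ∃ C > 0, ∀ A > 0, IntegrableOn F (Metric.ball 0 A) ∧
      ∫ ξ in Metric.ball 0 A, ‖F ξ‖ ≤ C * A ^ ((N : ℝ) / 2 - s) := by
  -- Cauchy-Schwarz for |F| = a·b: a is square integrable on balls because 2s < N, and its norm
  -- there scales like A^(N/2 - s).
  set a : RN N → ℝ := fun ξ => (2 * Real.pi * ‖ξ‖) ^ (-s) with ha
  set b : RN N → ℝ := fun ξ => ‖(((2 * Real.pi * ‖ξ‖) ^ s : ℝ) : ℂ) * F ξ‖ with hb
  have ham : Measurable a := by fun_prop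
  have ha0 : ∀ ξ, 0 ≤ a ξ := fun ξ => by positivity
  have hasq : ∀ ξ, a ξ ^ 2 = (2 * Real.pi * ‖ξ‖) ^ (-(2 * s)) := fun ξ => by
    rw [ha, ← Real.rpow_natCast, ← Real.rpow_mul (by positivity)]; congr 1; push_cast; ring
  have haL : ∀ A, MemLp a 2 (volume.restrict (Metric.ball (0 : RN N) A)) := fun A => by
    rw [memLp_two_iff_integrable_sq ham.aestronglyMeasurable]
    simp only [hasq]
    exact integrableOn_ball_norm_rpow hN0 hN A
  have hbL : MemLp b 2 volume := hF.norm
  have hab : ∀ A, (fun ξ => a ξ * b ξ) =ᵐ[volume.restrict (Metric.ball (0 : RN N) A)]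
      fun ξ => ‖F ξ‖ := fun A => by
    filter_upwards [ae_restrict_of_ae (ae_ne_zero hN0)] with ξ hξ
    have : 0 < 2 * Real.pi * ‖ξ‖ := by have := norm_pos_iff.2 hξ; positivity
    simp only [ha, hb, norm_mul, Complex.norm_real]
    rw [Real.norm_of_nonneg (by positivity), ← mul_assoc, ← Real.rpow_add this]
    simp
  -- The summand 1 keeps the constant positive even when F = 0.
  refine ⟨(∫ ξ : RN N in Metric.ball 0 1, (2 * Real.pi * ‖ξ‖) ^ (-(2 * s))) ^ (1 / 2 : ℝ) *
    (∫ ξ, b ξ ^ 2) ^ (1 / 2 : ℝ) + 1, by positivity, fun A hA => ⟨?_, ?_⟩⟩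
  · have h1 := (haL A).integrable_mul (hbL.restrict (Metric.ball (0 : RN N) A))
    have h2 : Integrable (fun ξ => ‖F ξ‖) (volume.restrict (Metric.ball (0 : RN N) A)) :=
      h1.congr (hab A)
    exact (integrable_norm_iff (Lp.aestronglyMeasurable F).restrict).1 h2
  · rw [← integral_congr_ae (hab A)]
    have h1 := integral_mul_le_Lp_mul_Lq_of_nonneg (p := 2) (q := 2)
      (μ := volume.restrict (Metric.ball (0 : RN N) A)) ⟨by norm_num, by norm_num, by norm_num⟩
      (Eventually.of_forall ha0) (Eventually.of_forall fun ξ => norm_nonneg _)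
      (f := a) (g := b)
      (by simpa using haL A) (by simpa using hbL.restrict (Metric.ball (0 : RN N) A))
    refine h1.trans ?_
    have e1 : ∫ ξ in Metric.ball (0 : RN N) A, a ξ ^ (2 : ℝ) = A ^ ((N : ℝ) - 2 * s) *
        ∫ ξ : RN N in Metric.ball 0 1, (2 * Real.pi * ‖ξ‖) ^ (-(2 * s)) := by
      rw [← setIntegral_ball_norm_rpow hA]
      simp only [Real.rpow_two, hasq]
    have e2 : ∫ ξ in Metric.ball (0 : RN N) A, b ξ ^ (2 : ℝ) ≤ ∫ ξ, b ξ ^ 2 := by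
      simp only [Real.rpow_two]
      exact setIntegral_le_integral hbL.integrable_sq
        (Eventually.of_forall fun ξ => by positivity)
    have hI0 : 0 ≤ ∫ ξ : RN N in Metric.ball 0 1, (2 * Real.pi * ‖ξ‖) ^ (-(2 * s)) :=
      integral_nonneg fun ξ => by positivity
    rw [e1, Real.mul_rpow (by positivity) hI0, ← Real.rpow_mul hA.le]
    have e3 : ((N : ℝ) - 2 * s) * (1 / 2) = N / 2 - s := by ring
    rw [e3]
    have e4 : (∫ ξ in Metric.ball (0 : RN N) A, b ξ ^ (2 : ℝ)) ^ (1 / 2 : ℝ)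
        ≤ (∫ ξ, b ξ ^ 2) ^ (1 / 2 : ℝ) :=
      Real.rpow_le_rpow (integral_nonneg fun ξ => by positivity) e2 (by norm_num)
    have hA' : 0 < A ^ ((N : ℝ) / 2 - s) := by positivity
    have hI1 := Real.rpow_nonneg hI0 (1 / 2)
    nlinarith [mul_le_mul_of_nonneg_left e4 (mul_nonneg hA'.le hI1)]

theorem eLpNorm_two_pow_eq {α E : Type*} [MeasurableSpace α] [NormedAddCommGroup E]
    {ν : Measure α} (f : α → E) : eLpNorm f 2 ν ^ 2 = ∫⁻ x, ‖f x‖ₑ ^ 2 ∂ν := by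
  have h := eLpNorm_nnreal_pow_eq_lintegral (p := 2) (μ := ν) (f := f) (by norm_num)
  simpa using h

theorem lintegral_enorm_sq_eq {N : ℕ} (f : Lp ℂ 2 (volume : Measure (RN N))) :
    ∫⁻ x, ‖f x‖ₑ ^ 2 = ‖f‖ₑ ^ 2 := by
  rw [Lp.enorm_def, eLpNorm_two_pow_eq]

theorem enorm_fourierInv_eq {N : ℕ} (f : Lp ℂ 2 (volume : Measure (RN N))) :
    ‖(𝓕⁻ f : Lp ℂ 2 (volume : Measure (RN N)))‖ₑ = ‖f‖ₑ := by
  have : ‖(𝓕⁻ f : Lp ℂ 2 (volume : Measure (RN N)))‖ = ‖f‖ :=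
    (Lp.fourierTransformₗᵢ (RN N) ℂ).symm.norm_map f
  rw [← ofReal_norm, this, ofReal_norm]

/-- Weak type estimate: the level sets of `𝓕⁻ F` are controlled by the high frequencies of `F`. -/
theorem measure_lt_norm_fourierInv_le {N : ℕ} (F : Lp ℂ 2 (volume : Measure (RN N))) {A t : ℝ}
    (ht : 0 < t) (hint : IntegrableOn F (Metric.ball 0 A))
    (hle : ∫ ξ in Metric.ball 0 A, ‖F ξ‖ ≤ t / 2) :
    volume {x | t < ‖(𝓕⁻ F : Lp ℂ 2 (volume : Measure (RN N))) x‖}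
      ≤ ENNReal.ofReal (4 / t ^ 2) * ∫⁻ ξ in (Metric.ball 0 A)ᶜ, ‖F ξ‖ₑ ^ 2 := by
  have hm : MeasurableSet (Metric.ball (0 : RN N) A) := Metric.isOpen_ball.measurableSet
  have hlo : MemLp ((Metric.ball (0 : RN N) A).indicator F) 2 volume := (Lp.memLp F).indicator hm
  have hhi : MemLp ((Metric.ball (0 : RN N) A)ᶜ.indicator F) 2 volume :=
    (Lp.memLp F).indicator hm.compl
  set l := hlo.toLp with hl
  set h := hhi.toLp with hh
  have hsum : F = l + h := by
    ext1
    filter_upwards [Lp.coeFn_add l h, hlo.coeFn_toLp, hhi.coeFn_toLp] with ξ h1 h2 h3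
    rw [h1, Pi.add_apply, h2, h3, ← Pi.add_apply, Set.indicator_self_add_compl]
  have hsum' : (𝓕⁻ F : Lp ℂ 2 (volume : Measure (RN N))) = 𝓕⁻ l + 𝓕⁻ h := by
    conv_lhs => rw [hsum]
    exact map_add (Lp.fourierTransformₗᵢ (RN N) ℂ).symm _ _
  have hlint : Integrable l :=
    ((integrable_indicator_iff hm).2 hint).congr hlo.coeFn_toLp.symm
  have hl1 : ∫ ξ, ‖l ξ‖ ≤ t / 2 := by
    refine le_trans (le_of_eq ?_) hle
    rw [← integral_indicator hm]
    refine integral_congr_ae ?_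
    filter_upwards [hlo.coeFn_toLp] with ξ h2
    rw [h2, norm_indicator_eq_indicator_norm]
  have hh1 : ∫⁻ x, ‖(𝓕⁻ h : Lp ℂ 2 (volume : Measure (RN N))) x‖ₑ ^ 2
      = ∫⁻ ξ in (Metric.ball 0 A)ᶜ, ‖F ξ‖ₑ ^ 2 := by
    rw [lintegral_enorm_sq_eq, enorm_fourierInv_eq, ← lintegral_enorm_sq_eq,
      ← lintegral_indicator hm.compl]
    refine lintegral_congr_ae ?_
    filter_upwards [hhi.coeFn_toLp] with ξ h3
    rw [h3]
    by_cases hξ : ξ ∈ (Metric.ball (0 : RN N) A)ᶜ <;> simp [hξ]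
  -- The low-frequency part is at most t/2 almost everywhere, so the high-frequency part exceeds t/2
  -- wherever the sum exceeds t. Chebyshev and Plancherel then apply to the high frequencies.
  have key : volume {x | t < ‖(𝓕⁻ F : Lp ℂ 2 (volume : Measure (RN N))) x‖}
      ≤ volume {x | ENNReal.ofReal (t ^ 2 / 4) ≤
        ‖(𝓕⁻ h : Lp ℂ 2 (volume : Measure (RN N))) x‖ₑ ^ 2} := by
    refine measure_mono_ae ?_
    filter_upwards [norm_fourierInv_Lp_le l hlint, Lp.coeFn_add (𝓕⁻ l) (𝓕⁻ h)] with x h1 h2 hx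
    change t < _ at hx
    change _ ≤ _
    rw [hsum', h2, Pi.add_apply] at hx
    have h3 := norm_add_le ((𝓕⁻ l : Lp ℂ 2 (volume : Measure (RN N))) x)
      ((𝓕⁻ h : Lp ℂ 2 (volume : Measure (RN N))) x)
    rw [← ofReal_norm, ← ENNReal.ofReal_pow (norm_nonneg _)]
    refine ENNReal.ofReal_le_ofReal ?_
    nlinarith
  refine key.trans ?_
  have h4 := mul_meas_ge_le_lintegral₀ (μ := (volume : Measure (RN N)))
    (f := fun x => ‖(𝓕⁻ h : Lp ℂ 2 (volume : Measure (RN N))) x‖ₑ ^ 2)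
    ((Lp.aestronglyMeasurable _).enorm.pow_const 2) (ENNReal.ofReal (t ^ 2 / 4))
  rw [hh1] at h4
  have h5 : ENNReal.ofReal (4 / t ^ 2) * ENNReal.ofReal (t ^ 2 / 4) = 1 := by
    rw [← ENNReal.ofReal_mul (by positivity)]
    simp [mul_comm, ht.ne']
  calc _ = ENNReal.ofReal (4 / t ^ 2) * (ENNReal.ofReal (t ^ 2 / 4) *
      volume {x | ENNReal.ofReal (t ^ 2 / 4) ≤
        ‖(𝓕⁻ h : Lp ℂ 2 (volume : Measure (RN N))) x‖ₑ ^ 2}) := by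
        rw [← mul_assoc, h5, one_mul]
    _ ≤ _ := by gcongr

theorem lintegral_Ioc_rpow {q R : ℝ} (hq : -1 < q) (hR : 0 ≤ R) :
    ∫⁻ t in Set.Ioc 0 R, ENNReal.ofReal (t ^ q) = ENNReal.ofReal (R ^ (q + 1) / (q + 1)) := by
  have hi : IntervalIntegrable (fun t : ℝ => t ^ q) volume 0 R :=
    intervalIntegral.intervalIntegrable_rpow' hq
  rw [← ofReal_integral_eq_lintegral_ofReal
      ((intervalIntegrable_iff_integrableOn_Ioc_of_le hR).1 hi)
      ((ae_restrict_iff' measurableSet_Ioc).2 (Eventually.of_forall fun t ht =>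
        Real.rpow_nonneg ht.1.le _)),
    ← intervalIntegral.integral_of_le hR, integral_rpow (Or.inl hq),
    Real.zero_rpow (by linarith), sub_zero]

/-- The critical fractional Sobolev embedding, by the frequency splitting of Chemin and Xu. -/
theorem lintegral_fourierInv_rpow_lt_top {N : ℕ} {s : ℝ} (hs0 : 0 < s) (hN : 2 * s < N)
    (F : Lp ℂ 2 (volume : Measure (RN N)))
    (hF : MemLp (fun ξ => (((2 * Real.pi * ‖ξ‖) ^ s : ℝ) : ℂ) * F ξ) 2 volume) :
    ∫⁻ x, ENNReal.ofReal (‖(𝓕⁻ F : Lp ℂ 2 (volume : Measure (RN N))) x‖ ^ critExp N s) < ⊤ := by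
  have hN0 : 0 < N := by
    have : (0 : ℝ) < N := by linarith
    exact_mod_cast this
  obtain ⟨C, hC, hlow⟩ := exists_setIntegral_ball_le hN0 hN F hF
  set p := critExp N s with hp
  set β : ℝ := (N : ℝ) / 2 - s with hβ
  have hβ0 : 0 < β := by rw [hβ]; linarith
  have hd : (N : ℝ) - 2 * s ≠ 0 := by linarith
  have hp2 : p - 2 = 4 * s / (N - 2 * s) := by rw [hp, critExp]; field_simp; ring
  have hp2' : 0 < p - 2 := by rw [hp2]; apply div_pos <;> linarith
  -- This relation singles out the critical exponent: integrating t^(p-3) up to a multiple of |ξ|^β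
  -- returns the weight |ξ|^(2s).
  have hβp : β * (p - 2) = 2 * s := by rw [hp2, hβ]; field_simp; ring
  set S : Set (ℝ × RN N) := {z | z.1 ≤ 2 * C * ‖z.2‖ ^ β} with hS
  have hSm : MeasurableSet S := measurableSet_le (by fun_prop) (by fun_prop)
  have hlevel : ∀ t > 0, volume {x | t < ‖(𝓕⁻ F : Lp ℂ 2 (volume : Measure (RN N))) x‖}
      ≤ ENNReal.ofReal (4 / t ^ 2) *
        ∫⁻ ξ, S.indicator (fun z => ‖F z.2‖ₑ ^ 2) (t, ξ) := by
    intro t ht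
    -- The cut-off radius depends on the level t and is chosen so that C·A^β = t/2. The condition
    -- |ξ| ≥ A then reads (t, ξ) ∈ S, ready for Fubini.
    have hA : 0 < (t / (2 * C)) ^ (1 / β) := by positivity
    have hAβ : ((t / (2 * C)) ^ (1 / β)) ^ β = t / (2 * C) := by
      rw [← Real.rpow_mul (by positivity), one_div_mul_cancel hβ0.ne', Real.rpow_one]
    obtain ⟨h1, h2⟩ := hlow _ hA
    rw [hAβ] at h2
    have h3 : C * (t / (2 * C)) = t / 2 := by field_simp
    refine (measure_lt_norm_fourierInv_le F ht h1 (h2.trans h3.le)).trans (le_of_eq ?_)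
    rw [← lintegral_indicator Metric.isOpen_ball.measurableSet.compl]
    congr 2
    funext ξ
    have : ξ ∈ (Metric.ball (0 : RN N) ((t / (2 * C)) ^ (1 / β)))ᶜ ↔ (t, ξ) ∈ S := by
      rw [hS, Set.mem_compl_iff, mem_ball_zero_iff, not_lt, Set.mem_ofPred_eq,
        ← Real.rpow_le_rpow_iff hA.le (norm_nonneg _) hβ0, hAβ, div_le_iff₀ (by positivity)]
      rw [mul_comm]
    by_cases hξ : (t, ξ) ∈ S
    · rw [Set.indicator_of_mem (this.2 hξ), Set.indicator_of_mem hξ]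
    · rw [Set.indicator_of_notMem (fun h => hξ (this.1 h)), Set.indicator_of_notMem hξ]
  have hFm : AEMeasurable (fun ξ => ‖F ξ‖ₑ ^ 2) (volume : Measure (RN N)) :=
    (Lp.aestronglyMeasurable F).enorm.pow_const 2
  rw [lintegral_rpow_eq_lintegral_meas_lt_mul volume (Eventually.of_forall fun x => norm_nonneg _)
    (Lp.aestronglyMeasurable _).norm.aemeasurable (by linarith : 0 < p)]
  refine ENNReal.mul_lt_top ENNReal.ofReal_lt_top ?_
  calc ∫⁻ t in Set.Ioi 0, volume {x | t < ‖(𝓕⁻ F : Lp ℂ 2 (volume : Measure (RN N))) x‖}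
        * ENNReal.ofReal (t ^ (p - 1))
      ≤ ∫⁻ t in Set.Ioi 0, ∫⁻ ξ, ENNReal.ofReal (4 * t ^ (p - 3)) *
          S.indicator (fun z => ‖F z.2‖ₑ ^ 2) (t, ξ) := by
        refine setLIntegral_mono' measurableSet_Ioi fun t ht => ?_
        rw [lintegral_const_mul' _ _ ENNReal.ofReal_ne_top]
        have e : 4 * t ^ (p - 3) = 4 / t ^ 2 * t ^ (p - 1) := by
          have : p - 1 = (p - 3) + 2 := by ring
          rw [this, Real.rpow_add ht, Real.rpow_two]
          have : t ≠ 0 := ne_of_gt ht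
          field_simp
        rw [e, ENNReal.ofReal_mul (by positivity), mul_right_comm]
        gcongr
        exact hlevel t ht
    _ = ∫⁻ ξ, ∫⁻ t in Set.Ioi 0, ENNReal.ofReal (4 * t ^ (p - 3)) *
          S.indicator (fun z => ‖F z.2‖ₑ ^ 2) (t, ξ) := by
        refine lintegral_lintegral_swap ?_
        refine AEMeasurable.mul (Measurable.aemeasurable (by fun_prop)) ?_
        exact (hFm.comp_snd).indicator hSm
    _ = ∫⁻ ξ, ENNReal.ofReal (4 * ((2 * C) ^ (p - 2) * (2 * Real.pi) ^ (-(2 * s)) / (p - 2))) *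
          ‖(((2 * Real.pi * ‖ξ‖) ^ s : ℝ) : ℂ) * F ξ‖ₑ ^ 2 := by
        refine lintegral_congr fun ξ => ?_
        have hR : 0 ≤ 2 * C * ‖ξ‖ ^ β := by positivity
        have e1 : ∫⁻ t in Set.Ioi 0, ENNReal.ofReal (4 * t ^ (p - 3)) *
            S.indicator (fun z => ‖F z.2‖ₑ ^ 2) (t, ξ)
            = ∫⁻ t in Set.Ioc 0 (2 * C * ‖ξ‖ ^ β), ENNReal.ofReal (t ^ (p - 3)) *
              (4 * ‖F ξ‖ₑ ^ 2) := by
          rw [← lintegral_indicator measurableSet_Ioi, ← lintegral_indicator measurableSet_Ioc]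
          refine lintegral_congr fun t => ?_
          by_cases h0 : 0 < t
          · by_cases h1 : t ≤ 2 * C * ‖ξ‖ ^ β
            · have hm : (t, ξ) ∈ S := h1
              rw [Set.indicator_of_mem (show t ∈ Set.Ioi 0 from h0),
                Set.indicator_of_mem (show t ∈ Set.Ioc 0 (2 * C * ‖ξ‖ ^ β) from ⟨h0, h1⟩),
                Set.indicator_of_mem hm, ENNReal.ofReal_mul (by norm_num)]
              rw [ENNReal.ofReal_ofNat]
              ring
            · have hm : (t, ξ) ∉ S := h1
              rw [Set.indicator_of_mem (show t ∈ Set.Ioi 0 from h0),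
                Set.indicator_of_notMem (show t ∉ Set.Ioc 0 (2 * C * ‖ξ‖ ^ β) from
                  fun h => h1 h.2), Set.indicator_of_notMem hm, mul_zero]
          · rw [Set.indicator_of_notMem (show t ∉ Set.Ioi 0 from h0),
              Set.indicator_of_notMem (show t ∉ Set.Ioc 0 (2 * C * ‖ξ‖ ^ β) from
                fun h => h0 h.1)]
        rw [e1, lintegral_mul_const' _ _ (ENNReal.mul_ne_top (by norm_num)
            (ENNReal.pow_ne_top enorm_ne_top)),
          lintegral_Ioc_rpow (by linarith) hR, enorm_mul, mul_pow,
          ← ofReal_norm (((2 * Real.pi * ‖ξ‖) ^ s : ℝ) : ℂ),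
          Complex.norm_real, Real.norm_of_nonneg (by positivity),
          ← ENNReal.ofReal_pow (by positivity), ← mul_assoc, ← mul_assoc,
          ← ENNReal.ofReal_mul (by positivity)]
        congr 1
        rw [show (4 : ℝ≥0∞) = ENNReal.ofReal 4 by simp, ← ENNReal.ofReal_mul 
            (div_nonneg (by positivity) (by linarith))]
        congr 1
        have e2 : p - 3 + 1 = p - 2 := by ring
        have e3 : ((2 * Real.pi * ‖ξ‖) ^ s) ^ 2 = (2 * Real.pi) ^ (2 * s) * ‖ξ‖ ^ (2 * s) := by
          rw [← Real.rpow_natCast, ← Real.rpow_mul (by positivity),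
            Real.mul_rpow (by positivity) (by positivity), mul_comm s]
          norm_num
        rw [e2, e3, Real.mul_rpow (by positivity) (by positivity), ← Real.rpow_mul (norm_nonneg _),
          hβp, Real.rpow_neg (by positivity)]
        have : (2 * Real.pi) ^ (2 * s) ≠ 0 := by positivity
        field_simp
    _ < ⊤ := by
        rw [lintegral_const_mul' _ _ ENNReal.ofReal_ne_top]
        refine ENNReal.mul_lt_top ENNReal.ofReal_lt_top ?_
        rw [← eLpNorm_two_pow_eq]
        exact ENNReal.pow_lt_top hF.2

theorem critExp_gt_two {N : ℕ} {s : ℝ} (hs0 : 0 < s) (hN : 2 * s < N) : 2 < critExp N s := by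
  rw [critExp, lt_div_iff₀ (by linarith)]
  linarith

theorem mem_Hs_iff {N : ℕ} {s : ℝ} {u : Lp ℝ 2 (volume : Measure (RN N))} :
    u ∈ Hs N s ↔ MemLp (symbolMul s u) 2 volume := Iff.rfl

theorem halfLap_eq {N : ℕ} {s : ℝ} (u : Hs N s)
    (h : MemLp (symbolMul s (u : Lp ℝ 2 (volume : Measure (RN N)))) 2 volume) :
    halfLap u = 𝓕⁻ (h.toLp : Lp ℂ 2 (volume : Measure (RN N))) := rfl

/-- Elements of `H^s(ℝ^N)` are integrable to the critical power. -/
theorem integrable_abs_rpow_critExp {N : ℕ} {s : ℝ} (hs0 : 0 < s) (hN : 2 * s < N) (u : Hs N s) :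
    Integrable (fun x => |(u : Lp ℝ 2 (volume : Measure (RN N))) x| ^ critExp N s) := by
  have h := lintegral_fourierInv_rpow_lt_top hs0 hN 
    (fourierL2 (u : Lp ℝ 2 (volume : Measure (RN N)))) (mem_Hs_iff.1 u.2)
  have h1 : (𝓕⁻ (fourierL2 (u : Lp ℝ 2 (volume : Measure (RN N)))) :
      Lp ℂ 2 (volume : Measure (RN N)))
      = Complex.ofRealCLM.compLp (u : Lp ℝ 2 (volume : Measure (RN N))) :=
    (Lp.fourierTransformₗᵢ (RN N) ℂ).symm_apply_apply _
  rw [h1] at h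
  simp only [← Real.norm_eq_abs]
  refine ⟨((Lp.aestronglyMeasurable _).norm.aemeasurable.pow_const _).aestronglyMeasurable, ?_⟩
  rw [hasFiniteIntegral_iff_ofReal (Eventually.of_forall fun x => by positivity)]
  refine lt_of_eq_of_lt (lintegral_congr_ae ?_) h
  filter_upwards [Complex.ofRealCLM.coeFn_compLp (u : Lp ℝ 2 (volume : Measure (RN N)))] with x hx
  rw [hx]
  simp

/-! ### The kinetic energy and the mass as quadratic forms. -/

theorem halfLap_add {N : ℕ} {s : ℝ} (u v : Hs N s) : halfLap (u + v) = halfLap u + halfLap v := by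
  have hu := mem_Hs_iff.1 u.2
  have hv := mem_Hs_iff.1 v.2
  have huv := mem_Hs_iff.1 (u + v).2
  have h : huv.toLp = hu.toLp + hv.toLp := by
    rw [← MemLp.toLp_add, MemLp.toLp_eq_toLp_iff]
    filter_upwards [Lp.coeFn_add (fourierL2 (u : Lp ℝ 2 (volume : Measure (RN N))))
      (fourierL2 (v : Lp ℝ 2 (volume : Measure (RN N))))] with ξ h
    simp only [symbolMul, Pi.add_apply, Submodule.coe_add, fourierL2_add, h, mul_add]
  rw [halfLap_eq _ huv, h]
  exact map_add (Lp.fourierTransformₗᵢ (RN N) ℂ).symm _ _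

theorem halfLap_smul {N : ℕ} {s : ℝ} (c : ℝ) (u : Hs N s) : halfLap (c • u) = c • halfLap u := by
  have hu := mem_Hs_iff.1 u.2
  have hcu := mem_Hs_iff.1 (c • u).2
  have h : hcu.toLp = c • hu.toLp := by
    rw [← MemLp.toLp_const_smul, MemLp.toLp_eq_toLp_iff]
    filter_upwards [Lp.coeFn_smul (c : ℂ) (fourierL2 (u : Lp ℝ 2 (volume : Measure (RN N))))]
      with ξ h
    simp only [symbolMul, Submodule.coe_smul, fourierL2_smul, h, Pi.smul_apply,
      smul_eq_mul, Complex.real_smul, mul_left_comm]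
  rw [halfLap_eq _ hcu, h]
  exact map_smul ((Lp.fourierTransformₗᵢ (RN N) ℂ).symm.toLinearEquiv.restrictScalars ℝ) c _

theorem kineticForm_eq_inner {N : ℕ} {s : ℝ} (u φ : Hs N s) :
    kineticForm u φ = inner ℝ (halfLap u) (halfLap φ) := (L2.inner_def _ _).symm

theorem kinetic_eq_norm_sq {N : ℕ} {s : ℝ} (u : Hs N s) : kinetic u = ‖halfLap u‖ ^ 2 := by
  rw [← real_inner_self_eq_norm_sq, L2.inner_def]
  simp only [real_inner_self_eq_norm_sq]
  rfl

theorem mass_eq_norm_sq {N : ℕ} {s : ℝ} (u : Hs N s) :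
    mass u = ‖(u : Lp ℝ 2 (volume : Measure (RN N)))‖ ^ 2 := by
  rw [← real_inner_self_eq_norm_sq, L2.inner_def]
  simp only [real_inner_self_eq_norm_sq, Real.norm_eq_abs, sq_abs]
  rfl

theorem kinetic_add_smul {N : ℕ} {s : ℝ} (u φ : Hs N s) (t : ℝ) :
    kinetic (u + t • φ) = kinetic u + 2 * t * kineticForm u φ + t ^ 2 * kinetic φ := by
  rw [kinetic_eq_norm_sq, kinetic_eq_norm_sq, kinetic_eq_norm_sq, kineticForm_eq_inner,
    halfLap_add, halfLap_smul, norm_add_sq_real, real_inner_smul_right, norm_smul, mul_pow,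
    Real.norm_eq_abs, sq_abs]
  ring

theorem mass_add_smul {N : ℕ} {s : ℝ} (u φ : Hs N s) (t : ℝ) :
    mass (u + t • φ) = mass u + 2 * t * (∫ x, (u : Lp ℝ 2 (volume : Measure (RN N))) x
      * (φ : Lp ℝ 2 (volume : Measure (RN N))) x) + t ^ 2 * mass φ := by
  have h : ∫ x, (u : Lp ℝ 2 (volume : Measure (RN N))) x
      * (φ : Lp ℝ 2 (volume : Measure (RN N))) x = inner ℝ (u : Lp ℝ 2 (volume : Measure (RN N)))
        (φ : Lp ℝ 2 (volume : Measure (RN N))) := by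
    rw [L2.inner_def]
    refine integral_congr_ae (Eventually.of_forall fun x => ?_)
    simp [mul_comm]
  rw [mass_eq_norm_sq, mass_eq_norm_sq, mass_eq_norm_sq, h, Submodule.coe_add, Submodule.coe_smul,
    norm_add_sq_real, real_inner_smul_right, norm_smul, mul_pow, Real.norm_eq_abs, sq_abs]
  ring

theorem kinetic_nonneg {N : ℕ} {s : ℝ} (u : Hs N s) : 0 ≤ kinetic u :=
  integral_nonneg fun _ => by positivity

theorem mass_pos {N : ℕ} {s : ℝ} {u : Hs N s} (hu : u ≠ 0) : 0 < mass u := by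
  rw [mass_eq_norm_sq]
  have : (u : Lp ℝ 2 (volume : Measure (RN N))) ≠ 0 := fun h => hu (Subtype.ext h)
  have := norm_pos_iff.2 this
  positivity

theorem mass_zero {N : ℕ} {s : ℝ} : mass (0 : Hs N s) = 0 := by
  rw [mass_eq_norm_sq]; simp

theorem kinetic_eq_norm_toLp_sq {N : ℕ} {s : ℝ} (u : Hs N s) : kinetic u =
    ‖MemLp.toLp (symbolMul s (u : Lp ℝ 2 (volume : Measure (RN N)))) u.2‖ ^ 2 := by
  rw [kinetic_eq_norm_sq, halfLap]
  congr 1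
  exact (Lp.fourierTransformₗᵢ (RN N) ℂ).symm.norm_map _

/-- The symbol vanishes only at the origin, a null set, so zero kinetic energy forces the Fourier
transform to vanish. Positivity makes the Bernoulli comparison strict. -/
theorem kinetic_pos {N : ℕ} {s : ℝ} (hN0 : 0 < N) {u : Hs N s} (hu : u ≠ 0) : 0 < kinetic u := by
  refine lt_of_le_of_ne (kinetic_nonneg u) fun h => hu ?_
  rw [kinetic_eq_norm_toLp_sq] at h
  have h1 : MemLp.toLp (symbolMul s (u : Lp ℝ 2 (volume : Measure (RN N)))) u.2 = 0 :=
    norm_eq_zero.1 (pow_eq_zero_iff (two_ne_zero)|>.1 h.symm)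
  have h2 : fourierL2 (u : Lp ℝ 2 (volume : Measure (RN N))) = 0 := by
    rw [Lp.eq_zero_iff_ae_eq_zero] at h1 ⊢
    filter_upwards [h1, MemLp.coeFn_toLp u.2, ae_ne_zero hN0] with ξ h3 h4 h5
    rw [h3, symbolMul] at h4
    have : 0 < 2 * Real.pi * ‖ξ‖ := by have := norm_pos_iff.2 h5; positivity
    have h6 : (((2 * Real.pi * ‖ξ‖) ^ s : ℝ) : ℂ) ≠ 0 := by
      exact_mod_cast (Real.rpow_pos_of_pos this s).ne'
    simpa [h6] using h4.symm
  have h3 : Complex.ofRealCLM.compLp (u : Lp ℝ 2 (volume : Measure (RN N))) = 0 :=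
    (Lp.fourierTransformₗᵢ (RN N) ℂ).map_eq_zero_iff.1 h2
  refine Subtype.ext ?_
  change (u : Lp ℝ 2 (volume : Measure (RN N))) = 0
  rw [Lp.eq_zero_iff_ae_eq_zero] at h3 ⊢
  filter_upwards [h3, Complex.ofRealCLM.coeFn_compLp (u : Lp ℝ 2 (volume : Measure (RN N)))]
    with x h4 h5
  rw [h4] at h5
  simpa using h5.symm

/-! ### Integrable test functions in `H^s`. -/

/-- Real Schwartz functions belong to `H^s`. -/
theorem schwartz_mem_Hs {N : ℕ} {s : ℝ} (hs0 : 0 < s) (hs1 : s < 1)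
    (φ : SchwartzMap (RN N) ℝ) : φ.toLp 2 (volume : Measure (RN N)) ∈ Hs N s := by
  change MemLp _ 2 volume
  set ψ : SchwartzMap (RN N) ℂ := φ.postcompCLM Complex.ofRealCLM with hψ
  have h1 : Complex.ofRealCLM.compLp (φ.toLp 2 (volume : Measure (RN N))) = ψ.toLp 2 := by
    ext1
    filter_upwards [Complex.ofRealCLM.coeFn_compLp (φ.toLp 2 (volume : Measure (RN N))),
      φ.coeFn_toLp 2 (volume : Measure (RN N)), ψ.coeFn_toLp 2 (volume : Measure (RN N))]
      with x h1 h2 h3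
    rw [h1, h2, h3, hψ, SchwartzMap.postcompCLM_apply]
  have h2 : fourierL2 (φ.toLp 2 (volume : Measure (RN N))) = (𝓕 ψ).toLp 2 := by
    rw [fourierL2, h1, SchwartzMap.toLp_fourier_eq]
  -- The symbol is not smooth at 0, so it is dominated by a polynomial: y^s ≤ 1 + y with y = 2π|ξ|,
  -- and 1 + 2π|ξ| ≤ 2π(1 + |ξ|²).
  have h3 : MemLp (fun ξ : RN N => ‖(2 * Real.pi * (1 + ‖ξ‖ ^ 2)) • (𝓕 ψ) ξ‖) 2 volume := by
    have hg : (fun ξ : RN N => 2 * Real.pi * (1 + ‖ξ‖ ^ 2)).HasTemperateGrowth := by fun_prop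
    have := (SchwartzMap.smulLeftCLM ℂ (fun ξ : RN N => 2 * Real.pi * (1 + ‖ξ‖ ^ 2))
      (𝓕 ψ)).memLp 2 (volume : Measure (RN N))
    refine (this.ae_eq (Eventually.of_forall fun ξ => ?_)).norm
    rw [SchwartzMap.smulLeftCLM_apply_apply hg]
  refine h3.mono' ?_ ?_
  · exact (Measurable.aestronglyMeasurable (by fun_prop)).mul (Lp.aestronglyMeasurable _)
  · filter_upwards [(𝓕 ψ).coeFn_toLp 2 (volume : Measure (RN N))] with ξ h
    rw [symbolMul, h2, h, norm_mul, norm_smul, Complex.norm_real,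
      Real.norm_of_nonneg (by positivity), Real.norm_of_nonneg (by positivity)]
    gcongr
    have hx : 0 ≤ 2 * Real.pi * ‖ξ‖ := by positivity
    have hpi := Real.pi_gt_three
    have h4 : (2 * Real.pi * ‖ξ‖) ^ s ≤ 1 + 2 * Real.pi * ‖ξ‖ := by
      rcases le_total (2 * Real.pi * ‖ξ‖) 1 with h | h
      · linarith [Real.rpow_le_one hx h hs0.le]
      · have := Real.rpow_le_rpow_of_exponent_le h hs1.le
        rw [Real.rpow_one] at this
        linarith
    nlinarith [mul_nonneg Real.pi_pos.le (sq_nonneg (‖ξ‖ - 1)),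
      mul_nonneg Real.pi_pos.le (sq_nonneg ‖ξ‖)]

theorem exists_schwartz_integral_mul_ne_zero {N : ℕ} (w : Lp ℝ 2 (volume : Measure (RN N)))
    (hw : w ≠ 0) : ∃ φ : SchwartzMap (RN N) ℝ,
      ∫ x, w x * φ.toLp 2 (volume : Measure (RN N)) x ≠ 0 := by
  by_contra! hc
  have hd : DenseRange (SchwartzMap.toLpCLM ℝ (E := RN N) ℝ 2 volume) :=
    SchwartzMap.denseRange_toLpCLM ENNReal.ofNat_ne_top
  have h : ∀ v : Lp ℝ 2 (volume : Measure (RN N)), inner ℝ w v = 0 := by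
    intro v
    refine hd.induction_on (p := fun v => inner ℝ w v = 0) v
      (isClosed_eq (by fun_prop) continuous_const) fun φ => ?_
    rw [L2.inner_def, ← hc φ]
    refine integral_congr_ae (Eventually.of_forall fun x => ?_)
    simp [mul_comm]
  exact hw (inner_self_eq_zero.1 (h w))

theorem exists_integrable_integral_mul_ne_zero {N : ℕ} {s : ℝ} (hs0 : 0 < s) (hs1 : s < 1)
    (w : Lp ℝ 2 (volume : Measure (RN N))) (hw : w ≠ 0) : ∃ φ : Hs N s,
      Integrable (φ : Lp ℝ 2 (volume : Measure (RN N))) ∧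
      ∫ x, w x * (φ : Lp ℝ 2 (volume : Measure (RN N))) x ≠ 0 := by
  obtain ⟨φ, hφ⟩ := exists_schwartz_integral_mul_ne_zero w hw
  obtain ⟨ψ, hψ⟩ : ∃ ψ : Hs N s, (ψ : Lp ℝ 2 (volume : Measure (RN N))) = φ.toLp 2 :=
    ⟨⟨_, schwartz_mem_Hs hs0 hs1 φ⟩, rfl⟩
  refine ⟨ψ, ?_, ?_⟩
  · rw [hψ]
    exact φ.integrable.congr (φ.coeFn_toLp 2 volume).symm
  · rw [hψ]
    exact hφ

/-! ### Dilations. -/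

theorem map_smul_volume {N : ℕ} {c : ℝ} (hc : 0 < c) :
    Measure.map (fun x : RN N => c • x) volume
      = ENNReal.ofReal ((c ^ N)⁻¹) • (volume : Measure (RN N)) := by
  rw [Measure.map_addHaar_smul volume hc.ne', finrank_euclideanSpace_fin,
    abs_of_pos (by positivity)]

theorem eLpNorm_comp_smul {N : ℕ} {E : Type*} [NormedAddCommGroup E] {c : ℝ} (hc : 0 < c)
    {f : RN N → E} (hf : AEStronglyMeasurable f volume) : eLpNorm (fun x => f (c • x)) 2 volume
      = ENNReal.ofReal ((c ^ N)⁻¹) ^ (1 / 2 : ℝ) * eLpNorm f 2 volume := by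
  have hm : AEStronglyMeasurable f (Measure.map (fun x : RN N => c • x) volume) := by
    rw [map_smul_volume hc]; exact hf.smul_measure _
  have h := eLpNorm_map_measure (p := 2) hm (measurable_const_smul c).aemeasurable
  rw [map_smul_volume hc, eLpNorm_smul_measure_of_ne_top (by norm_num)] at h
  rw [Function.comp_def] at h
  rw [← h]
  simp

theorem memLp_comp_smul {N : ℕ} {E : Type*} [NormedAddCommGroup E] {c : ℝ} (hc : 0 < c)
    {f : RN N → E} (hf : MemLp f 2 volume) : MemLp (fun x => f (c • x)) 2 volume := by
  refine ⟨hf.1.comp_quasiMeasurePreserving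
    (Measure.quasiMeasurePreserving_smul volume hc.ne'), ?_⟩
  rw [eLpNorm_comp_smul hc hf.1]
  exact ENNReal.mul_lt_top (ENNReal.rpow_lt_top_of_nonneg (by norm_num) ENNReal.ofReal_ne_top) hf.2

theorem ae_comp_smul {N : ℕ} {c : ℝ} (hc : 0 < c) {p : RN N → Prop} (hp : ∀ᵐ x, p x) :
    ∀ᵐ x : RN N, p (c • x) :=
  (Measure.quasiMeasurePreserving_smul (volume : Measure (RN N)) hc.ne').ae hp

/-- The dilation `f ↦ f(c ·)` on complex `L²`. -/
def dilateL {N : ℕ} {c : ℝ} (hc : 0 < c) :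
    Lp ℂ 2 (volume : Measure (RN N)) →L[ℂ] Lp ℂ 2 (volume : Measure (RN N)) :=
  LinearMap.mkContinuous
    { toFun := fun f => (memLp_comp_smul hc (Lp.memLp f)).toLp
      map_add' := fun f g => by
        rw [← MemLp.toLp_add, MemLp.toLp_eq_toLp_iff]
        filter_upwards [ae_comp_smul hc (Lp.coeFn_add f g)] with x h
        simpa using h
      map_smul' := fun a f => by
        rw [RingHom.id_apply, ← MemLp.toLp_const_smul, MemLp.toLp_eq_toLp_iff]
        filter_upwards [ae_comp_smul hc (Lp.coeFn_smul a f)] with x h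
        simpa using h }
    (ENNReal.ofReal ((c ^ N)⁻¹) ^ (1 / 2 : ℝ)).toReal fun f => by
      rw [LinearMap.coe_mk, AddHom.coe_mk, Lp.norm_toLp, eLpNorm_comp_smul hc
        (Lp.aestronglyMeasurable f), ENNReal.toReal_mul, Lp.norm_def]

theorem coeFn_dilateL {N : ℕ} {c : ℝ} (hc : 0 < c) (f : Lp ℂ 2 (volume : Measure (RN N))) :
    dilateL hc f =ᵐ[volume] fun x => f (c • x) :=
  MemLp.coeFn_toLp (memLp_comp_smul hc (Lp.memLp f))

/-- Both sides are continuous in f, so it suffices to change variables in the Fourier integral of a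
Schwartz function. -/
theorem fourier_dilateL {N : ℕ} {c : ℝ} (hc : 0 < c) (f : Lp ℂ 2 (volume : Measure (RN N))) :
    (𝓕 (dilateL hc f) : Lp ℂ 2 (volume : Measure (RN N)))
      = (((c ^ N)⁻¹ : ℝ) : ℂ) • dilateL (inv_pos.2 hc) (𝓕 f) := by
  have hd : DenseRange (SchwartzMap.toLpCLM ℂ (E := RN N) ℂ 2 volume) :=
    SchwartzMap.denseRange_toLpCLM ENNReal.ofNat_ne_top
  refine hd.induction_on (p := fun f => (𝓕 (dilateL hc f) : Lp ℂ 2 (volume : Measure (RN N)))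
      = (((c ^ N)⁻¹ : ℝ) : ℂ) • dilateL (inv_pos.2 hc) (𝓕 f)) f (isClosed_eq ?_ ?_) fun φ => ?_
  · exact (Lp.fourierTransformₗᵢ (RN N) ℂ).continuous.comp (dilateL hc).continuous
  · exact (continuous_const_smul (((c ^ N)⁻¹ : ℝ) : ℂ)).comp
      ((dilateL (inv_pos.2 hc)).continuous.comp (Lp.fourierTransformₗᵢ (RN N) ℂ).continuous)
  · set ψ : SchwartzMap (RN N) ℂ := SchwartzMap.compCLMOfContinuousLinearEquiv ℂ
      (ContinuousLinearEquiv.smulLeft (R₁ := ℝ) (Units.mk0 c hc.ne')) φ with hψ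
    have hψx : ∀ x, ψ x = φ (c • x) := fun x => rfl
    have h1 : dilateL hc (SchwartzMap.toLpCLM ℂ (E := RN N) ℂ 2 volume φ) = ψ.toLp 2 := by
      ext1
      filter_upwards [coeFn_dilateL hc (SchwartzMap.toLpCLM ℂ (E := RN N) ℂ 2 volume φ),
        ψ.coeFn_toLp 2 (volume : Measure (RN N)),
        ae_comp_smul hc (φ.coeFn_toLp 2 (volume : Measure (RN N)))] with x h1 h2 h3
      rw [h1, h2, hψx, SchwartzMap.toLpCLM_apply, h3]
    rw [h1, SchwartzMap.toLpCLM_apply, SchwartzMap.toLp_fourier_eq, SchwartzMap.toLp_fourier_eq]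
    ext1
    filter_upwards [(𝓕 ψ).coeFn_toLp 2 (volume : Measure (RN N)),
      Lp.coeFn_smul (((c ^ N)⁻¹ : ℝ) : ℂ) (dilateL (inv_pos.2 hc) ((𝓕 φ).toLp 2)),
      coeFn_dilateL (inv_pos.2 hc) ((𝓕 φ).toLp 2),
      ae_comp_smul (inv_pos.2 hc) ((𝓕 φ).coeFn_toLp 2 (volume : Measure (RN N)))] with ξ h1 h2 h3 h4
    rw [h1, h2, Pi.smul_apply, h3, h4, SchwartzMap.fourier_coe, SchwartzMap.fourier_coe,
      Real.fourier_eq, Real.fourier_eq]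
    have h5 := Measure.integral_comp_smul_of_nonneg (volume : Measure (RN N))
      (fun v => Real.fourierChar (-inner ℝ v (c⁻¹ • ξ)) • φ v) c (hR := hc.le)
    rw [finrank_euclideanSpace_fin] at h5
    rw [Complex.coe_smul, ← h5]
    refine integral_congr_ae (Eventually.of_forall fun v => ?_)
    simp only [hψx, inner_smul_left, inner_smul_right]
    congr 3
    simp [hc.ne']

/-- Dilations act on `H^s(ℝ^N)` and scale the kinetic energy. -/
theorem exists_dilation {N : ℕ} {s : ℝ} (u : Hs N s) {r : ℝ} (hr : 0 < r) :
    ∃ v : Hs N s, ((v : Lp ℝ 2 (volume : Measure (RN N))) =ᵐ[volume]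
        fun x => (u : Lp ℝ 2 (volume : Measure (RN N))) (r⁻¹ • x)) ∧
      kinetic v = r ^ ((N : ℝ) - 2 * s) * kinetic u := by
  have hc := inv_pos.2 hr
  have hL := memLp_comp_smul hc (Lp.memLp (u : Lp ℝ 2 (volume : Measure (RN N))))
  have h1 : Complex.ofRealCLM.compLp hL.toLp
      = dilateL hc (Complex.ofRealCLM.compLp (u : Lp ℝ 2 (volume : Measure (RN N)))) := by
    ext1
    filter_upwards [Complex.ofRealCLM.coeFn_compLp hL.toLp, hL.coeFn_toLp,
      coeFn_dilateL hc (Complex.ofRealCLM.compLp (u : Lp ℝ 2 (volume : Measure (RN N)))),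
      ae_comp_smul hc (Complex.ofRealCLM.coeFn_compLp (u : Lp ℝ 2 (volume : Measure (RN N))))]
      with x h1 h2 h3 h4
    rw [h1, h2, h3, h4]
  -- The dilated transform contributes r^N and |ξ|^s = r^(-s)|rξ|^s contributes r^(-s). After
  -- squaring, the change of variables costs r^(-N), leaving r^(N-2s).
  have h2 : symbolMul s hL.toLp =ᵐ[volume]
      fun ξ => (r ^ ((N : ℝ) - s)) •
        symbolMul s (u : Lp ℝ 2 (volume : Measure (RN N))) (r • ξ) := by
    have hf : fourierL2 hL.toLp = ((((r⁻¹) ^ N)⁻¹ : ℝ) : ℂ) • dilateL (inv_pos.2 hc)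
        (fourierL2 (u : Lp ℝ 2 (volume : Measure (RN N)))) := by
      rw [fourierL2, h1, fourier_dilateL]; rfl
    filter_upwards [Lp.coeFn_smul ((((r⁻¹) ^ N)⁻¹ : ℝ) : ℂ) (dilateL (inv_pos.2 hc)
        (fourierL2 (u : Lp ℝ 2 (volume : Measure (RN N))))), coeFn_dilateL (inv_pos.2 hc)
        (fourierL2 (u : Lp ℝ 2 (volume : Measure (RN N))))] with ξ h3 h4
    rw [symbolMul, symbolMul, hf, h3, Pi.smul_apply, h4, inv_inv, norm_smul,
      Real.norm_of_nonneg hr.le, smul_eq_mul, Complex.real_smul, ← mul_assoc, ← mul_assoc,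
      ← Complex.ofReal_mul, ← Complex.ofReal_mul, inv_pow, inv_inv]
    congr 2
    rw [show 2 * Real.pi * (r * ‖ξ‖) = r * (2 * Real.pi * ‖ξ‖) by ring,
      Real.mul_rpow hr.le (by positivity), ← mul_assoc, ← Real.rpow_add hr, sub_add_cancel,
      Real.rpow_natCast, mul_comm]
  have hu := mem_Hs_iff.1 u.2
  have hmem : hL.toLp ∈ Hs N s :=
    mem_Hs_iff.2 (((memLp_comp_smul hr hu).const_smul (r ^ ((N : ℝ) - s))).ae_eq h2.symm)
  refine ⟨⟨hL.toLp, hmem⟩, hL.coeFn_toLp, ?_⟩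
  have hk : ∀ w : Hs N s, kinetic w = (eLpNorm (symbolMul s
      (w : Lp ℝ 2 (volume : Measure (RN N)))) 2 volume).toReal ^ 2 := fun w => by
    rw [kinetic_eq_norm_toLp_sq]
    exact congrArg (· ^ 2) (Lp.norm_toLp _ (mem_Hs_iff.1 w.2))
  rw [hk, hk, eLpNorm_congr_ae h2]
  have h5 := eLpNorm_const_smul (r ^ ((N : ℝ) - s)) (fun ξ : RN N => symbolMul s
    (u : Lp ℝ 2 (volume : Measure (RN N))) (r • ξ)) 2 volume
  rw [eLpNorm_comp_smul hr hu.1] at h5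
  erw [h5]
  rw [ENNReal.toReal_mul, ENNReal.toReal_mul, mul_pow, mul_pow, ← mul_assoc]
  congr 1
  rw [← ENNReal.toReal_rpow, ENNReal.toReal_ofReal (by positivity), toReal_enorm,
    Real.norm_of_nonneg (by positivity), ← Real.rpow_natCast, ← Real.rpow_natCast,
    ← Real.rpow_mul hr.le, ← Real.rpow_mul (by positivity)]
  norm_num
  rw [← Real.rpow_natCast, ← Real.rpow_neg hr.le, ← Real.rpow_add hr]
  congr 1
  ring

/-! ### Growth of the nonlinearity and of its primitive. -/

theorem CondG0.hasDerivAt_primitive {g : ℝ → ℝ} (hg0 : CondG0 g) (t : ℝ) :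
    HasDerivAt (primitive g) (g t) t :=
  intervalIntegral.integral_hasDerivAt_right (hg0.1.intervalIntegrable _ _)
    hg0.1.aestronglyMeasurable.stronglyMeasurableAtFilter hg0.1.continuousAt

theorem CondG0.continuous_primitive {g : ℝ → ℝ} (hg0 : CondG0 g) : Continuous (primitive g) :=
  continuous_iff_continuousAt.2 fun t => (hg0.hasDerivAt_primitive t).continuousAt

theorem primitive_zero (g : ℝ → ℝ) : primitive g 0 = 0 := by simp [primitive]

/-- The growth of `g` is at most critical. -/
theorem exists_abs_le_of_condG2 {N : ℕ} {s : ℝ} {g : ℝ → ℝ} (hg0 : CondG0 g)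
    (hg2 : CondG2 N s g) : ∃ C ≥ 0, ∀ t, |g t| ≤ C * (1 + |t| ^ (critExp N s - 1)) := by
  obtain ⟨c, hc, -⟩ := EReal.lt_iff_exists_real_btwn.1 hg2
  have h := eventually_lt_of_limsup_lt hc
  rw [eventually_comap] at h
  obtain ⟨R, hR⟩ := eventually_atTop.1 h
  obtain ⟨D, hD⟩ := (isCompact_Icc (a := -(max R 1)) (b := max R 1)).exists_bound_of_continuousOn
    hg0.1.continuousOn
  refine ⟨max c 0 + max D 0, by positivity, fun t => ?_⟩
  have hp : 0 ≤ |t| ^ (critExp N s - 1) := by positivity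
  have hc0 : c ≤ max c 0 := le_max_left _ _
  have hc1 : 0 ≤ max c 0 := le_max_right _ _
  have hD0 : D ≤ max D 0 := le_max_left _ _
  have hD1 : 0 ≤ max D 0 := le_max_right _ _
  rcases le_total |t| (max R 1) with ht | ht
  · have := hD t (abs_le.1 ht)
    rw [Real.norm_eq_abs] at this
    nlinarith [mul_nonneg hc1 hp, mul_nonneg hD1 hp]
  · have h1 := hR |t| ((le_max_left _ _).trans ht) t rfl
    have ht0 : 0 < |t| := lt_of_lt_of_le (by positivity) ht
    have hpos : 0 < |t| ^ (critExp N s - 1) := by positivity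
    have h2 : |g t| / |t| ^ (critExp N s - 1) < c := by exact_mod_cast h1
    rw [div_lt_iff₀ hpos] at h2
    nlinarith [mul_nonneg hc1 hp, mul_nonneg hD1 hp, mul_le_mul_of_nonneg_right hc0 hp]

theorem abs_primitive_sub_le {g : ℝ → ℝ} (hg0 : CondG0 g) {C q : ℝ} (hC : 0 ≤ C) (hq : 0 ≤ q)
    (hg : ∀ t, |g t| ≤ C * (1 + |t| ^ q)) (a b : ℝ) :
    |primitive g (a + b) - primitive g a| ≤ C * (1 + (|a| + |b|) ^ q) * |b| := by
  have h := (convex_uIcc a (a + b)).norm_image_sub_le_of_norm_hasDerivWithin_le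
    (f := primitive g) (f' := g) (C := C * (1 + (|a| + |b|) ^ q))
    (fun x _ => (hg0.hasDerivAt_primitive x).hasDerivWithinAt) (fun x hx => ?_)
    Set.left_mem_uIcc Set.right_mem_uIcc
  · simpa using h
  · refine (hg x).trans ?_
    have h1 := Set.abs_sub_left_of_mem_uIcc hx
    have h2 : |x| ≤ |a| + |b| := by
      have h3 := abs_sub_abs_le_abs_sub x a
      have h4 : a + b - a = b := by ring
      rw [h4] at h1
      linarith
    gcongr

/-- The positive part of `G` is controlled by `t² + |t|^{2^*_s}`. -/
theorem exists_primitive_le {N : ℕ} {s : ℝ} (hs0 : 0 < s) (hN : 2 * s < N) {g : ℝ → ℝ}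
    (hg0 : CondG0 g) (hg1 : CondG1 g) (hg2 : CondG2 N s g) :
    ∃ C ≥ 0, ∀ t, primitive g t ≤ C * (t ^ 2 + |t| ^ critExp N s) := by
  have hp := critExp_gt_two hs0 hN
  obtain ⟨D, hD0, hD⟩ := exists_abs_le_of_condG2 hg0 hg2
  -- Any positive number would serve as the bound. With 1, integrating g(τ)/τ < 1 gives G(t) ≤ t²/2
  -- near 0 on both sides.
  have h1 : limsup (fun t : ℝ => ((g t / t : ℝ) : EReal)) (𝓝[≠] 0) < ((1 : ℝ) : EReal) :=
    lt_of_le_of_lt hg1 (by norm_num)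
  have h2 := eventually_lt_of_limsup_lt h1
  rw [eventually_nhdsWithin_iff, Metric.eventually_nhds_iff] at h2
  obtain ⟨δ, hδ, h3⟩ := h2
  have hsmall : ∀ t, |t| < δ → primitive g t ≤ t ^ 2 / 2 := by
    intro t ht
    have hlt : ∀ τ, τ ≠ 0 → |τ| < δ → g τ / τ < 1 := fun τ h0 hτ => by
      have := h3 (y := τ) (by simpa using hτ) h0
      exact_mod_cast this
    have hid : ∫ τ in (0 : ℝ)..t, τ = t ^ 2 / 2 := by simp [integral_id]
    rw [← hid, primitive]
    rcases le_total 0 t with h0 | h0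
    · refine intervalIntegral.integral_mono_on h0 (hg0.1.intervalIntegrable _ _)
        (continuous_id.intervalIntegrable _ _) fun τ hτ => ?_
      rcases eq_or_lt_of_le hτ.1 with h4 | h4
      · rw [← h4, hg0.2]
      · have := hlt τ h4.ne' (lt_of_le_of_lt (by
          rw [abs_of_nonneg hτ.1, abs_of_nonneg h0]; exact hτ.2) ht)
        rw [div_lt_one h4] at this
        exact this.le
    · rw [intervalIntegral.integral_symm, intervalIntegral.integral_symm (f := fun τ => τ)]
      refine neg_le_neg (intervalIntegral.integral_mono_on h0
        (continuous_id.intervalIntegrable _ _) (hg0.1.intervalIntegrable _ _) fun τ hτ => ?_)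
      rcases eq_or_lt_of_le hτ.2 with h4 | h4
      · rw [h4, hg0.2]
      · have := hlt τ h4.ne (lt_of_le_of_lt (by
          rw [abs_of_nonpos hτ.2, abs_of_nonpos h0]; linarith [hτ.1]) ht)
        rw [div_lt_one_of_neg h4] at this
        exact this.le
  -- The term D/δ absorbs the linear growth away from 0: D|t| ≤ (D/δ)t² once |t| ≥ δ.
  refine ⟨1 + D / δ + D, by positivity, fun t => ?_⟩
  have hpow : 0 ≤ |t| ^ critExp N s := by positivity
  have hDδ : 0 ≤ D / δ := by positivity
  rcases lt_or_ge |t| δ with ht | ht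
  · have := hsmall t ht
    nlinarith [mul_nonneg hDδ (sq_nonneg t), mul_nonneg hD0 (sq_nonneg t), sq_nonneg t,
      mul_nonneg hDδ hpow, mul_nonneg hD0 hpow]
  · have h4 := abs_primitive_sub_le hg0 hD0 (by linarith) hD 0 t
    rw [primitive_zero, zero_add, sub_zero, abs_zero, zero_add] at h4
    have ht0 : 0 < |t| := lt_of_lt_of_le hδ ht
    have h5 : |t| ^ (critExp N s - 1) * |t| = |t| ^ critExp N s := by
      rw [← Real.rpow_add_one ht0.ne']; congr 1; ring
    have h6 : D * |t| ≤ D / δ * t ^ 2 := by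
      rw [div_mul_eq_mul_div, le_div_iff₀ hδ, ← sq_abs]
      nlinarith [mul_nonneg hD0 ht0.le]
    have h7 := le_abs_self (primitive g t)
    have h8 : D * (1 + |t| ^ (critExp N s - 1)) * |t| = D * |t| + D * |t| ^ critExp N s := by
      rw [← h5]; ring
    nlinarith [mul_nonneg hD0 (sq_nonneg t), sq_nonneg t, mul_nonneg hDδ hpow]

/-! ### The extended-valued potential and its derivative. -/

theorem extIntegral_of_integrable {N : ℕ} {f : RN N → ℝ} (hf : Integrable f) :
    extIntegral f = ((∫ x, f x : ℝ) : EReal) := by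
  rw [extIntegral, integral_eq_lintegral_pos_part_sub_lintegral_neg_part hf, EReal.coe_sub,
    EReal.coe_ennreal_toReal hf.lintegral_lt_top.ne,
    EReal.coe_ennreal_toReal (by simpa using hf.neg.lintegral_lt_top.ne)]

theorem extIntegral_of_not_integrable {N : ℕ} {f : RN N → ℝ} (hfm : AEStronglyMeasurable f volume)
    (hf : ¬ Integrable f) (hpos : ∫⁻ x, ENNReal.ofReal (f x) < ⊤) : extIntegral f = ⊥ := by
  have hneg : ∫⁻ x, ENNReal.ofReal (-f x) = ⊤ := by
    by_contra hne
    refine hf ⟨hfm, ?_⟩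
    have h : ∀ x, ‖f x‖ₑ = ENNReal.ofReal (f x) + ENNReal.ofReal (-f x) := fun x => by
      rw [← ofReal_norm, Real.norm_eq_abs]
      rcases le_total 0 (f x) with h | h
      · rw [abs_of_nonneg h, ENNReal.ofReal_of_nonpos (p := -f x) (by linarith), add_zero]
      · rw [abs_of_nonpos h, ENNReal.ofReal_of_nonpos (p := f x) h, zero_add]
    rw [HasFiniteIntegral]
    simp only [h]
    rw [lintegral_add_left' hfm.aemeasurable.ennreal_ofReal]
    exact ENNReal.add_lt_top.2 ⟨hpos, lt_top_iff_ne_top.2 hne⟩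
  rw [extIntegral, hneg, EReal.coe_ennreal_top]
  exact EReal.sub_top _

/-- The potential `G(u)` is integrable, so that `∫ G(u) > -∞`. -/
def FinitePotential {N : ℕ} {s : ℝ} (g : ℝ → ℝ) (u : Hs N s) : Prop :=
  Integrable (fun x => primitive g ((u : Lp ℝ 2 (volume : Measure (RN N))) x))

/-- The value of `∫ G(u)` as a real number. -/
def potentialReal {N : ℕ} {s : ℝ} (g : ℝ → ℝ) (u : Hs N s) : ℝ :=
  ∫ x, primitive g ((u : Lp ℝ 2 (volume : Measure (RN N))) x)

theorem FinitePotential.potential_eq {N : ℕ} {s : ℝ} {g : ℝ → ℝ} {u : Hs N s}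
    (h : FinitePotential g u) : potential g u = ((potentialReal g u : ℝ) : EReal) :=
  extIntegral_of_integrable h

/-- The Sobolev embedding makes the positive part of G(u) integrable, so non-integrability can only
come from the negative part. -/
theorem potential_eq_bot {N : ℕ} {s : ℝ} (hs0 : 0 < s) (hN : 2 * s < N) {g : ℝ → ℝ}
    (hg0 : CondG0 g) (hg1 : CondG1 g) (hg2 : CondG2 N s g) {u : Hs N s}
    (h : ¬ FinitePotential g u) : potential g u = ⊥ := by
  refine extIntegral_of_not_integrable
    (hg0.continuous_primitive.comp_aestronglyMeasurable (Lp.aestronglyMeasurable _)) h ?_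
  obtain ⟨C, hC, hle⟩ := exists_primitive_le hs0 hN hg0 hg1 hg2
  have hint : Integrable (fun x => C * ((u : Lp ℝ 2 (volume : Measure (RN N))) x ^ 2
      + |(u : Lp ℝ 2 (volume : Measure (RN N))) x| ^ critExp N s)) :=
    (((Lp.memLp _).integrable_sq).add (integrable_abs_rpow_critExp hs0 hN u)).const_mul C
  exact lt_of_le_of_lt (lintegral_mono fun x => ENNReal.ofReal_le_ofReal (hle _))
    hint.lintegral_lt_top

/-- The constant 1 is paired with φ ∈ L¹ and the power is bounded by (|u| + |φ|) to the critical
exponent. This one function dominates both G(u+φ) - G(u) and g(u+tφ)φ for |t| ≤ 1. -/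
theorem integrable_perturbation_bound {N : ℕ} {s : ℝ} (hs0 : 0 < s) (hN : 2 * s < N) (C : ℝ)
    (u φ : Hs N s) (hφ : Integrable (φ : Lp ℝ 2 (volume : Measure (RN N)))) :
    Integrable (fun x => C * (1 + (|(u : Lp ℝ 2 (volume : Measure (RN N))) x|
      + |(φ : Lp ℝ 2 (volume : Measure (RN N))) x|) ^ (critExp N s - 1))
        * |(φ : Lp ℝ 2 (volume : Measure (RN N))) x|) := by
  have hp := critExp_gt_two hs0 hN
  have hmem : ∀ w : Hs N s, MemLp (fun x => |(w : Lp ℝ 2 (volume : Measure (RN N))) x|)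
      (ENNReal.ofReal (critExp N s)) volume := fun w => by
    simp only [← Real.norm_eq_abs]
    rw [← integrable_norm_rpow_iff (Lp.aestronglyMeasurable _).norm
      (by simpa using by linarith) ENNReal.ofReal_ne_top, ENNReal.toReal_ofReal (by linarith)]
    simpa using integrable_abs_rpow_critExp hs0 hN w
  have hsum := ((hmem u).add (hmem φ)).integrable_norm_rpow (by simpa using by linarith)
    ENNReal.ofReal_ne_top
  rw [ENNReal.toReal_ofReal (by linarith)] at hsum
  have hm : AEStronglyMeasurable (fun x => C * (1 + (|(u : Lp ℝ 2 (volume : Measure (RN N))) x|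
      + |(φ : Lp ℝ 2 (volume : Measure (RN N))) x|) ^ (critExp N s - 1))
        * |(φ : Lp ℝ 2 (volume : Measure (RN N))) x|) volume := by
    have h1 := (Lp.aestronglyMeasurable (u : Lp ℝ 2 (volume : Measure (RN N)))).aemeasurable
    have h2 := (Lp.aestronglyMeasurable (φ : Lp ℝ 2 (volume : Measure (RN N)))).aemeasurable
    exact AEMeasurable.aestronglyMeasurable (by fun_prop)
  refine ((hφ.norm.add hsum).const_mul |C|).mono' hm (Eventually.of_forall fun x => ?_)
  set a := |(u : Lp ℝ 2 (volume : Measure (RN N))) x| with ha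
  set b := |(φ : Lp ℝ 2 (volume : Measure (RN N))) x| with hb
  have ha0 : 0 ≤ a := abs_nonneg _
  have hb0 : 0 ≤ b := abs_nonneg _
  have h1 : 0 ≤ (a + b) ^ (critExp N s - 1) := by positivity
  rw [norm_mul, norm_mul, Real.norm_of_nonneg hb0, Real.norm_eq_abs, mul_assoc,
    Real.norm_of_nonneg (by positivity)]
  refine mul_le_mul_of_nonneg_left ?_ (abs_nonneg _)
  simp only [Pi.add_apply, Real.norm_eq_abs, ← ha, ← hb, abs_of_nonneg (add_nonneg ha0 hb0)]
  have h2 : (a + b) ^ (critExp N s - 1) * (a + b) = (a + b) ^ critExp N s := by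
    conv_lhs => rw [← Real.rpow_one (a + b), ← Real.rpow_mul (by positivity), one_mul]
    rw [← Real.rpow_add_of_nonneg (by positivity) (by linarith) (by linarith)]
    congr 1; ring
  nlinarith [mul_nonneg h1 ha0]

theorem FinitePotential.add {N : ℕ} {s : ℝ} (hs0 : 0 < s) (hN : 2 * s < N) {g : ℝ → ℝ}
    (hg0 : CondG0 g) (hg2 : CondG2 N s g) {u φ : Hs N s} (hu : FinitePotential g u)
    (hφ : Integrable (φ : Lp ℝ 2 (volume : Measure (RN N)))) : FinitePotential g (u + φ) := by
  obtain ⟨C, hC, hle⟩ := exists_abs_le_of_condG2 hg0 hg2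
  have hp := critExp_gt_two hs0 hN
  have h1 : Integrable (fun x => primitive g ((u : Lp ℝ 2 (volume : Measure (RN N))) x
      + (φ : Lp ℝ 2 (volume : Measure (RN N))) x)
        - primitive g ((u : Lp ℝ 2 (volume : Measure (RN N))) x)) := by
    refine (integrable_perturbation_bound hs0 hN C u φ hφ).mono' ?_
      (Eventually.of_forall fun x => abs_primitive_sub_le hg0 hC (by linarith) hle _ _)
    exact (hg0.continuous_primitive.comp_aestronglyMeasurable
      ((Lp.aestronglyMeasurable _).add (Lp.aestronglyMeasurable _))).sub
      (hg0.continuous_primitive.comp_aestronglyMeasurable (Lp.aestronglyMeasurable _))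
  refine (h1.add hu).congr ?_
  filter_upwards [Lp.coeFn_add (u : Lp ℝ 2 (volume : Measure (RN N)))
    (φ : Lp ℝ 2 (volume : Measure (RN N)))] with x h
  rw [Submodule.coe_add, h]
  simp

theorem finitePotential_zero {N : ℕ} {s : ℝ} (g : ℝ → ℝ) : FinitePotential g (0 : Hs N s) := by
  refine (integrable_zero (RN N) ℝ volume).congr ?_
  filter_upwards [Lp.coeFn_zero ℝ 2 (volume : Measure (RN N))] with x h
  rw [Submodule.coe_zero, h]
  simp [primitive_zero]

theorem hasDerivAt_potentialReal {N : ℕ} {s : ℝ} (hs0 : 0 < s) (hN : 2 * s < N) {g : ℝ → ℝ}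
    (hg0 : CondG0 g) (hg2 : CondG2 N s g) {u φ : Hs N s} (hu : FinitePotential g u)
    (hφ : Integrable (φ : Lp ℝ 2 (volume : Measure (RN N)))) :
    HasDerivAt (fun t : ℝ => potentialReal g (u + t • φ))
      (∫ x, g ((u : Lp ℝ 2 (volume : Measure (RN N))) x)
        * (φ : Lp ℝ 2 (volume : Measure (RN N))) x) 0 := by
  obtain ⟨C, hC, hle⟩ := exists_abs_le_of_condG2 hg0 hg2
  have hp := critExp_gt_two hs0 hN
  have hum := Lp.aestronglyMeasurable (u : Lp ℝ 2 (volume : Measure (RN N)))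
  have hφm := Lp.aestronglyMeasurable (φ : Lp ℝ 2 (volume : Measure (RN N)))
  have hfun : (fun t : ℝ => potentialReal g (u + t • φ)) = fun t : ℝ =>
      ∫ x, primitive g ((u : Lp ℝ 2 (volume : Measure (RN N))) x
        + t * (φ : Lp ℝ 2 (volume : Measure (RN N))) x) := by
    funext t
    refine integral_congr_ae ?_
    filter_upwards [Lp.coeFn_add (u : Lp ℝ 2 (volume : Measure (RN N)))
      (t • (φ : Lp ℝ 2 (volume : Measure (RN N)))),
      Lp.coeFn_smul t (φ : Lp ℝ 2 (volume : Measure (RN N)))] with x h1 h2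
    rw [Submodule.coe_add, Submodule.coe_smul, h1, Pi.add_apply, h2]
    simp
  rw [hfun]
  have h := hasDerivAt_integral_of_dominated_loc_of_deriv_le (μ := (volume : Measure (RN N)))
    (x₀ := (0 : ℝ)) (s := Metric.ball 0 1)
    (F := fun t x => primitive g ((u : Lp ℝ 2 (volume : Measure (RN N))) x
        + t * (φ : Lp ℝ 2 (volume : Measure (RN N))) x))
    (F' := fun t x => g ((u : Lp ℝ 2 (volume : Measure (RN N))) x
        + t * (φ : Lp ℝ 2 (volume : Measure (RN N))) x)
          * (φ : Lp ℝ 2 (volume : Measure (RN N))) x)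
    (Metric.ball_mem_nhds 0 one_pos)
    (Eventually.of_forall fun t => hg0.continuous_primitive.comp_aestronglyMeasurable
      (hum.add (hφm.const_mul t)))
    (by unfold FinitePotential at hu; simpa using hu)
    ((hg0.1.comp_aestronglyMeasurable (hum.add (hφm.const_mul 0))).mul hφm)
    (Eventually.of_forall fun x t ht => ?_)
    (integrable_perturbation_bound hs0 hN C u φ hφ)
    (Eventually.of_forall fun x t _ => ?_)
  · simpa using h.2
  · rw [norm_mul, Real.norm_eq_abs, Real.norm_eq_abs]
    refine mul_le_mul_of_nonneg_right ((hle _).trans ?_) (abs_nonneg _)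
    have ht1 : |t| ≤ 1 := by simpa using (mem_ball_zero_iff.1 ht).le
    have h1 : |(u : Lp ℝ 2 (volume : Measure (RN N))) x
        + t * (φ : Lp ℝ 2 (volume : Measure (RN N))) x|
        ≤ |(u : Lp ℝ 2 (volume : Measure (RN N))) x|
          + |(φ : Lp ℝ 2 (volume : Measure (RN N))) x| := by
      refine (abs_add_le _ _).trans ?_
      rw [abs_mul]
      gcongr
      exact mul_le_of_le_one_left (abs_nonneg _) ht1
    have : 0 ≤ critExp N s - 1 := by linarith
    gcongr
  · have h1 := (hg0.hasDerivAt_primitive ((u : Lp ℝ 2 (volume : Measure (RN N))) x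
        + t * (φ : Lp ℝ 2 (volume : Measure (RN N))) x)).comp t
        (((hasDerivAt_id t).mul_const ((φ : Lp ℝ 2 (volume : Measure (RN N))) x)).const_add
          ((u : Lp ℝ 2 (volume : Measure (RN N))) x))
    rw [one_mul] at h1
    exact h1

/-! ### Reduction of the Pohozaev set to a graph, and rescaling to the sphere. -/

theorem FinitePotential.energy_eq {N : ℕ} {s : ℝ} {g : ℝ → ℝ} {u : Hs N s}
    (h : FinitePotential g u) :
    energy g u = ((kinetic u / 2 - potentialReal g u : ℝ) : EReal) := by
  rw [energy, h.potential_eq, EReal.coe_sub]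

theorem energy_eq_top {N : ℕ} {s : ℝ} (hs0 : 0 < s) (hN : 2 * s < N) {g : ℝ → ℝ}
    (hg0 : CondG0 g) (hg1 : CondG1 g) (hg2 : CondG2 N s g) {u : Hs N s}
    (h : ¬ FinitePotential g u) : energy g u = ⊤ := by
  rw [energy, potential_eq_bot hs0 hN hg0 hg1 hg2 h]
  exact EReal.coe_sub_bot _

theorem FinitePotential.lagrangian_eq {N : ℕ} {s : ℝ} {g : ℝ → ℝ} {u : Hs N s}
    (h : FinitePotential g u) (m ν : ℝ) : lagrangian g m (ν, u)
      = ((kinetic u / 2 + ν / 2 * (mass u - m) - potentialReal g u : ℝ) : EReal) := by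
  rw [lagrangian, h.potential_eq, EReal.coe_sub]

theorem FinitePotential.pohozaev_eq {N : ℕ} {s : ℝ} {g : ℝ → ℝ} {u : Hs N s}
    (h : FinitePotential g u) (ν : ℝ) : pohozaev g (ν, u)
      = ((kinetic u + critExp N s * (ν / 2 * mass u - potentialReal g u) : ℝ) : EReal) := by
  rw [pohozaev, h.potential_eq, ← EReal.coe_sub, ← EReal.coe_mul, ← EReal.coe_add]

/-- The only multiplier for which the Pohozaev identity can hold. -/
def pohozaevMultiplier {N : ℕ} {s : ℝ} (g : ℝ → ℝ) (u : Hs N s) : ℝ :=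
  2 / mass u * (potentialReal g u - kinetic u / critExp N s)

/-- The Lagrangian on the Pohozaev set, expressed through `u` alone. -/
def reducedLagrangian {N : ℕ} {s : ℝ} (g : ℝ → ℝ) (m : ℝ) (u : Hs N s) : ℝ :=
  s / N * kinetic u - m / mass u * (potentialReal g u - kinetic u / critExp N s)

theorem mem_pohozaevSet_iff {N : ℕ} {s : ℝ} (hs0 : 0 < s) (hN : 2 * s < N) {g : ℝ → ℝ}
    (hg0 : CondG0 g) (hg1 : CondG1 g) (hg2 : CondG2 N s g) (ν : ℝ) (u : Hs N s) :
    (ν, u) ∈ pohozaevSet N s g ↔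
      u ≠ 0 ∧ FinitePotential g u ∧ ν = pohozaevMultiplier g u := by
  have hp := critExp_gt_two hs0 hN
  by_cases h : FinitePotential g u
  · rw [pohozaevSet, Set.mem_ofPred_eq, h.pohozaev_eq, ← EReal.coe_zero, EReal.coe_eq_coe_iff]
    refine and_congr_right fun hu => ?_
    have hM : mass u ≠ 0 := (mass_pos hu).ne'
    have hp0 : critExp N s ≠ 0 := by linarith
    simp only [h, true_and, pohozaevMultiplier]
    rw [show 2 / mass u * (potentialReal g u - kinetic u / critExp N s)
      = 2 * (potentialReal g u - kinetic u / critExp N s) / mass u by ring, eq_div_iff hM]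
    constructor
    · intro h1
      field_simp
      linarith
    · intro h1
      rw [show ν / 2 * mass u = potentialReal g u - kinetic u / critExp N s by linarith]
      field_simp
      ring
  · refine iff_of_false (fun hmem => ?_) fun h1 => h h1.2.1
    have h1 := hmem.2
    rw [pohozaev, potential_eq_bot hs0 hN hg0 hg1 hg2 h, EReal.coe_sub_bot,
      EReal.coe_mul_top_of_pos (by linarith), EReal.coe_add_top] at h1
    exact EReal.top_ne_zero h1

theorem half_eq_div_add_inv_critExp {N : ℕ} {s : ℝ} (hs0 : 0 < s) (hN : 2 * s < N) :
    (1 : ℝ) / 2 = s / N + 1 / critExp N s := by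
  have h1 : (N : ℝ) ≠ 0 := by linarith
  have h2 : (N : ℝ) - 2 * s ≠ 0 := by linarith
  rw [critExp]
  field_simp
  ring

theorem FinitePotential.lagrangian_pohozaevMultiplier {N : ℕ} {s : ℝ} (hs0 : 0 < s)
    (hN : 2 * s < N) {g : ℝ → ℝ} {u : Hs N s} (h : FinitePotential g u) (hu : u ≠ 0) (m : ℝ) :
    lagrangian g m (pohozaevMultiplier g u, u) = (reducedLagrangian g m u : EReal) := by
  have hM : mass u ≠ 0 := (mass_pos hu).ne'
  rw [h.lagrangian_eq, EReal.coe_eq_coe_iff, pohozaevMultiplier, reducedLagrangian,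
    div_eq_mul_one_div (kinetic u) 2, half_eq_div_add_inv_critExp hs0 hN]
  field_simp
  ring

theorem reducedLagrangian_of_mass_eq {N : ℕ} {s : ℝ} (hs0 : 0 < s) (hN : 2 * s < N) {g : ℝ → ℝ}
    {m : ℝ} (hm : 0 < m) {u : Hs N s} (hu : mass u = m) :
    reducedLagrangian g m u = kinetic u / 2 - potentialReal g u := by
  rw [reducedLagrangian, hu, div_self hm.ne', div_eq_mul_one_div (kinetic u) 2,
    half_eq_div_add_inv_critExp hs0 hN]
  ring

/-- Rescaling to the `L²`-sphere lowers the reduced Lagrangian to the energy. -/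
theorem exists_mass_eq_le_reducedLagrangian {N : ℕ} {s : ℝ} (hs0 : 0 < s) (hN : 2 * s < N)
    {g : ℝ → ℝ} {m : ℝ} (hm : 0 < m) {v : Hs N s} (hv : v ≠ 0)
    (hfin : FinitePotential g v) : ∃ w : Hs N s, mass w = m ∧ FinitePotential g w ∧
      kinetic w / 2 - potentialReal g w ≤ reducedLagrangian g m v ∧
      (mass v ≠ m → kinetic w / 2 - potentialReal g w < reducedLagrangian g m v) := by
  have hNr : (0 : ℝ) < N := by linarith
  have hN0 : 0 < N := by exact_mod_cast hNr
  have hM := mass_pos hv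
  have hT := kinetic_pos hN0 hv
  set x := m / mass v with hx
  have hx0 : 0 < x := by positivity
  -- Dilation by r multiplies every ∫ f(v) by r^N, so r^N = m / `mass v` gives mass m.
  set r := x ^ (1 / (N : ℝ)) with hr
  have hr0 : 0 < r := by positivity
  have hrN : r ^ N = x := by
    rw [hr, ← Real.rpow_natCast, ← Real.rpow_mul hx0.le, one_div_mul_cancel hNr.ne', Real.rpow_one]
  obtain ⟨w, hw, hkin⟩ := exists_dilation v hr0
  have hscale : ∀ f : ℝ → ℝ, ∫ y, f ((w : Lp ℝ 2 (volume : Measure (RN N))) y)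
      = x * ∫ y, f ((v : Lp ℝ 2 (volume : Measure (RN N))) y) := fun f => by
    have h1 := Measure.integral_comp_inv_smul_of_nonneg (volume : Measure (RN N))
      (fun y => f ((v : Lp ℝ 2 (volume : Measure (RN N))) y)) hr0.le
    rw [finrank_euclideanSpace_fin, hrN, smul_eq_mul] at h1
    rw [← h1]
    refine integral_congr_ae ?_
    filter_upwards [hw] with y hy
    rw [hy]
  have hmass : mass w = m := by
    have := hscale fun t => t ^ 2
    rw [mass, this, hx]
    exact div_mul_cancel₀ m hM.ne'
  have hpot : potentialReal g w = x * potentialReal g v := hscale (primitive g)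
  have hwfin : FinitePotential g w := by
    have h1 := Integrable.comp_smul (μ := (volume : Measure (RN N))) hfin
      (inv_ne_zero hr0.ne')
    refine h1.congr ?_
    filter_upwards [hw] with y hy
    rw [hy]
  have hrpow : r ^ ((N : ℝ) - 2 * s) = x ^ (1 / (N : ℝ) * (N - 2 * s)) := by
    rw [hr, ← Real.rpow_mul hx0.le]
  set a := 1 / (N : ℝ) * (N - 2 * s) with ha
  have ha0 : 0 < a := mul_pos (by positivity) (by linarith)
  have ha1 : a < 1 := by rw [ha, one_div, inv_mul_lt_iff₀ hNr]; linarith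
  have hsN : s / N = (1 - a) / 2 := by rw [ha]; field_simp; ring
  have hcrit : 1 / critExp N s = a / 2 := by
    have := half_eq_div_add_inv_critExp hs0 hN
    rw [hsN] at this
    linarith
  have hred : reducedLagrangian g m v
      = kinetic v / 2 * ((1 - a) + a * x) - x * potentialReal g v := by
    rw [reducedLagrangian, div_eq_mul_one_div (kinetic v) (critExp N s), hcrit, hsN]
    ring
  refine ⟨w, hmass, hwfin, ?_, fun hne => ?_⟩
  · rw [hred, hkin, hpot, hrpow]
    -- The potential terms agree on both sides; what remains is Bernoulli's inequality x^a ≤ 1 + a(x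
    -- - 1) times T/2.
    have h1 := rpow_one_add_le_one_add_mul_self (s := x - 1) (p := a) (by linarith)
      ha0.le ha1.le
    rw [add_sub_cancel] at h1
    nlinarith
  · rw [hred, hkin, hpot, hrpow]
    have hx1 : x - 1 ≠ 0 := fun h => hne ((div_eq_one_iff_eq hM.ne').1 (by linarith)).symm
    have h1 := rpow_one_add_lt_one_add_mul_self (s := x - 1) (p := a) (by linarith) hx1
      ha0 ha1
    rw [add_sub_cancel] at h1
    nlinarith

/-! ### The Euler-Lagrange equation and the equivalence. -/

/-- Minimisers of the reduced Lagrangian of mass `m` solve the equation, with the multiplier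
given by the Pohozaev identity. -/
theorem isWeakSolution_of_forall_le {N : ℕ} {s : ℝ} (hs0 : 0 < s) (hN : 2 * s < N) {g : ℝ → ℝ}
    (hg0 : CondG0 g) (hg2 : CondG2 N s g) {m : ℝ} (hm : 0 < m) {u : Hs N s} (hu : mass u = m)
    (hfin : FinitePotential g u) (hmin : ∀ v : Hs N s, v ≠ 0 → FinitePotential g v →
      reducedLagrangian g m u ≤ reducedLagrangian g m v) :
    IsWeakSolution g (pohozaevMultiplier g u) u := by
  intro φ hφ
  have hp := critExp_gt_two hs0 hN
  have hM : HasDerivAt (fun t : ℝ => mass (u + t • φ))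
      (2 * ∫ x, (u : Lp ℝ 2 (volume : Measure (RN N))) x
        * (φ : Lp ℝ 2 (volume : Measure (RN N))) x) 0 := by
    simp only [mass_add_smul]
    have h := ((((hasDerivAt_id (0 : ℝ)).const_mul 2).mul_const
      (∫ x, (u : Lp ℝ 2 (volume : Measure (RN N))) x
        * (φ : Lp ℝ 2 (volume : Measure (RN N))) x)).const_add (mass u)).add
      (((hasDerivAt_id (0 : ℝ)).pow 2).mul_const (mass φ))
    refine (h.congr_deriv ?_).congr_of_eventuallyEq (Eventually.of_forall fun t => ?_)
    · simp
    · simp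
  have hT : HasDerivAt (fun t : ℝ => kinetic (u + t • φ)) (2 * kineticForm u φ) 0 := by
    simp only [kinetic_add_smul]
    have h := ((((hasDerivAt_id (0 : ℝ)).const_mul 2).mul_const
      (kineticForm u φ)).const_add (kinetic u)).add
      (((hasDerivAt_id (0 : ℝ)).pow 2).mul_const (kinetic φ))
    refine (h.congr_deriv ?_).congr_of_eventuallyEq (Eventually.of_forall fun t => ?_)
    · simp
    · simp
  have hV := hasDerivAt_potentialReal hs0 hN hg0 hg2 hfin hφ
  have hM0 : mass (u + (0 : ℝ) • φ) = m := by rw [zero_smul, add_zero, hu]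
  have hJ := (hT.const_mul (s / N)).sub
    (((hasDerivAt_const (0 : ℝ) m).div hM (by rw [hM0]; exact hm.ne')).mul
      (hV.sub (hT.div_const (critExp N s))))
  have hloc : IsLocalMin (fun t : ℝ => reducedLagrangian g m (u + t • φ)) 0 := by
    -- Positive mass keeps the perturbed functions nonzero, hence admissible in `hmin`; no mass
    -- constraint is imposed on the variation.
    have hpos : ∀ᶠ t : ℝ in 𝓝 0, 0 < mass (u + t • φ) :=
      hM.continuousAt.eventually_const_lt (hm.trans_eq hM0.symm)
    filter_upwards [hpos] with t ht
    rw [zero_smul, add_zero]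
    refine hmin _ (fun h => ?_) (hfin.add hs0 hN hg0 hg2 ?_)
    · rw [h, mass_zero] at ht
      exact ht.false
    · refine (hφ.const_mul t).congr ?_
      filter_upwards [Lp.coeFn_smul t (φ : Lp ℝ 2 (volume : Measure (RN N)))] with x hx
      rw [Submodule.coe_smul, hx]
      rfl
  have hzero := hloc.hasDerivAt_eq_zero hJ
  simp only [Pi.sub_apply, Pi.div_apply, zero_smul, add_zero, hu] at hzero
  have hhalf := half_eq_div_add_inv_critExp hs0 hN
  rw [div_eq_mul_one_div (2 * kineticForm u φ), div_eq_mul_one_div (kinetic u)] at hzero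
  rw [pohozaevMultiplier, hu, div_eq_mul_one_div (kinetic u)]
  -- The two multiples of `kineticForm u φ` now add up to coefficient 1, and differentiating m/M
  -- produces the term with the multiplier.
  rw [show s / (N : ℝ) = 1 / 2 - 1 / critExp N s by linarith] at hzero
  field_simp at hzero ⊢
  linarith

/-- Subtracting the two equations leaves (μ - ν)∫ uφ = 0, and some admissible test function has ∫ uφ
≠ 0. -/
theorem IsWeakSolution.multiplier_unique {N : ℕ} {s : ℝ} (hs0 : 0 < s) (hs1 : s < 1) {g : ℝ → ℝ}
    {μ ν : ℝ} {u : Hs N s} (hu : u ≠ 0) (h1 : IsWeakSolution g μ u) (h2 : IsWeakSolution g ν u) :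
    μ = ν := by
  obtain ⟨φ, hint, hφ⟩ := exists_integrable_integral_mul_ne_zero hs0 hs1
    (u : Lp ℝ 2 (volume : Measure (RN N))) fun h => hu (Subtype.ext h)
  have e1 := h1 φ hint
  have e2 := h2 φ hint
  exact mul_right_cancel₀ hφ (by linarith)

/-- The energy is finite somewhere on the sphere. -/
theorem exists_mass_eq_finitePotential {N : ℕ} {s m : ℝ} (hs0 : 0 < s) (hs1 : s < 1)
    (hN : 2 * s < N) (hm : 0 < m) {g : ℝ → ℝ} (hg0 : CondG0 g) (hg2 : CondG2 N s g) :
    ∃ w : Hs N s, mass w = m ∧ FinitePotential g w := by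
  -- Any nonzero w would do: it only serves to produce a nonzero integrable element of `H^s`, which
  -- is then dilated to mass m.
  obtain ⟨w, hw⟩ : ∃ w : Lp ℝ 2 (volume : Measure (RN N)), w ≠ 0 := by
    have h2 : 0 < (volume : Measure (RN N)).real (Metric.ball 0 1) :=
      ENNReal.toReal_pos (Metric.measure_ball_pos _ _ one_pos).ne' measure_ball_lt_top.ne
    refine ⟨indicatorConstLp 2 (measurableSet_ball (x := (0 : RN N)) (ε := 1))
      measure_ball_lt_top.ne (1 : ℝ), norm_pos_iff.1 ?_⟩
    rw [norm_indicatorConstLp (by norm_num) (by norm_num)]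
    exact mul_pos (by norm_num) (Real.rpow_pos_of_pos h2 _)
  obtain ⟨v, hint, hv⟩ := exists_integrable_integral_mul_ne_zero hs0 hs1 w hw
  have hv0 : v ≠ 0 := fun h => hv <| by
    rw [h, Submodule.coe_zero]
    refine integral_eq_zero_of_ae ?_
    filter_upwards [Lp.coeFn_zero ℝ 2 (volume : Measure (RN N))] with x hx
    rw [hx]
    simp
  have hfin : FinitePotential g v := by
    have := (finitePotential_zero (s := s) g).add hs0 hN hg0 hg2 hint
    rwa [zero_add] at this
  obtain ⟨w, hw, hwfin, -⟩ := exists_mass_eq_le_reducedLagrangian hs0 hN hm hv0 hfin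
  exact ⟨w, hw, hwfin⟩

/-- `L²`-minima and Pohozaev minima coincide. -/
theorem isL2Minimum_iff_isPohozaevMinimum {N : ℕ} {s m : ℝ} (hs0 : 0 < s) (hs1 : s < 1) (hN : 2 * s < N) (hm : 0 < m)
    {g : ℝ → ℝ} (hg0 : CondG0 g) (hg1 : CondG1 g) (hg2 : CondG2 N s g)
    (μ : ℝ) (u : Hs N s) :
    IsL2Minimum g m μ u ↔ IsPohozaevMinimum g m μ u := by
  have hne : ∀ v : Hs N s, mass v = m → v ≠ 0 := fun v hv h => by
    rw [h, mass_zero] at hv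
    exact hm.ne hv
  constructor
  · rintro ⟨hmass, hmin, hweak⟩
    change mass u = m at hmass
    have hu0 := hne u hmass
    have hfin : FinitePotential g u := by
      by_contra hnot
      obtain ⟨w, hw, hwfin⟩ := exists_mass_eq_finitePotential hs0 hs1 hN hm hg0 hg2
      have h1 : energy g u ≤ energy g w := hmin hw
      rw [energy_eq_top hs0 hN hg0 hg1 hg2 hnot, hwfin.energy_eq, top_le_iff] at h1
      exact EReal.coe_ne_top _ h1
    have hred : ∀ v : Hs N s, v ≠ 0 → FinitePotential g v →
        reducedLagrangian g m u ≤ reducedLagrangian g m v := fun v hv hvfin => by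
      obtain ⟨w, hw, hwfin, hle, -⟩ := exists_mass_eq_le_reducedLagrangian hs0 hN hm hv hvfin
      have h1 : energy g u ≤ energy g w := hmin hw
      rw [hfin.energy_eq, hwfin.energy_eq, EReal.coe_le_coe_iff] at h1
      rw [reducedLagrangian_of_mass_eq hs0 hN hm hmass]
      exact h1.trans hle
    -- The Pohozaev identity for u comes from minimality: u also solves the equation with the
    -- Pohozaev multiplier, and multipliers are unique.
    have hμ : μ = pohozaevMultiplier g u := hweak.multiplier_unique hs0 hs1 hu0
      (isWeakSolution_of_forall_le hs0 hN hg0 hg2 hm hmass hfin hred)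
    refine ⟨(mem_pohozaevSet_iff hs0 hN hg0 hg1 hg2 μ u).2 ⟨hu0, hfin, hμ⟩, ?_⟩
    rintro ⟨ν, v⟩ hv
    obtain ⟨hv0, hvfin, hν⟩ := (mem_pohozaevSet_iff hs0 hN hg0 hg1 hg2 ν v).1 hv
    change lagrangian g m (μ, u) ≤ lagrangian g m (ν, v)
    rw [hμ, hν, hfin.lagrangian_pohozaevMultiplier hs0 hN hu0,
      hvfin.lagrangian_pohozaevMultiplier hs0 hN hv0, EReal.coe_le_coe_iff]
    exact hred v hv0 hvfin
  · rintro ⟨hmem, hmin⟩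
    obtain ⟨hu0, hfin, hμ⟩ := (mem_pohozaevSet_iff hs0 hN hg0 hg1 hg2 μ u).1 hmem
    have hred : ∀ v : Hs N s, v ≠ 0 → FinitePotential g v →
        reducedLagrangian g m u ≤ reducedLagrangian g m v := fun v hv hvfin => by
      have h1 : lagrangian g m (μ, u) ≤ lagrangian g m (pohozaevMultiplier g v, v) :=
        hmin ((mem_pohozaevSet_iff hs0 hN hg0 hg1 hg2 _ v).2 ⟨hv, hvfin, rfl⟩)
      rwa [hμ, hfin.lagrangian_pohozaevMultiplier hs0 hN hu0,
        hvfin.lagrangian_pohozaevMultiplier hs0 hN hv, EReal.coe_le_coe_iff] at h1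
    -- A minimiser of the wrong mass would be strictly beaten by its own dilation to the sphere.
    have hmass : mass u = m := by
      by_contra hne'
      obtain ⟨w, hw, hwfin, -, hlt⟩ :=
        exists_mass_eq_le_reducedLagrangian hs0 hN hm hu0 hfin
      have h1 := hred w (hne w hw) hwfin
      rw [reducedLagrangian_of_mass_eq hs0 hN hm hw] at h1
      exact absurd (hlt hne') (not_lt.2 h1)
    refine ⟨hmass, fun v hv => ?_, ?_⟩
    · change energy g u ≤ energy g v
      by_cases hvfin : FinitePotential g v
      · rw [hfin.energy_eq, hvfin.energy_eq, EReal.coe_le_coe_iff,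
          ← reducedLagrangian_of_mass_eq hs0 hN hm hmass,
          ← reducedLagrangian_of_mass_eq hs0 hN hm hv]
        exact hred v (hne v hv) hvfin
      · rw [energy_eq_top hs0 hN hg0 hg1 hg2 hvfin]
        exact le_top
    · rw [hμ]
      exact isWeakSolution_of_forall_le hs0 hN hg0 hg2 hm hmass hfin hred

end FracNLS

end


theorem corollary1p8 (N : ℕ) (s m : ℝ) (hs0 : 0 < s) (hs1 : s < 1) (hN : 2 * s < N) (hm : 0 < m)
    (g : ℝ → ℝ) (hg0 : FracNLS.CondG0 g) (hg1 : FracNLS.CondG1 g) (hg2 : FracNLS.CondG2 N s g)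
    (μ : ℝ) (u : FracNLS.Hs N s) :
    FracNLS.IsL2Minimum g m μ u ↔ FracNLS.IsPohozaevMinimum g m μ u :=
  FracNLS.isL2Minimum_iff_isPohozaevMinimum hs0 hs1 hN hm hg0 hg1 hg2 μ u
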